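/- A Bayesian game consists of: a finite set of players $\{1,\dots,n\}$, $n\ge 2$; a probability space $(\Omega,\mathcal F,P)$; for each player $i$, a sub-$\sigma$-field $\mathcal F_i\subseteq\mathcal F$ (her information), a nonempty measurable space of actions $\mathcal A_i$, and a measurable payoff function $R_i:\Omega\times\mathcal A\to\mathbb R$, where $\mathcal A=\prod_i\mathcal A_i$ carries the product $\sigma$-field. A strategy of player $i$ is an $\mathcal F_i$-measurable map $s_i:\Omega\to\Delta(\mathcal A_i)$, i.e. each $s_i(\omega)$ is a probability measure on $\mathcal A_i$ and $\omega\mapsto s_i(\omega)(B)$ is $\mathcal F_i$-measurable for every measurable $B\subseteq\mathcal A_i$. A strategy profile $s=(s_i)_i$ induces the probability measure $P_s$ on $\Omega\times\mathcal A$ determined by $$P_s(\Omega_1\times B_1\times\dots\times B_n)=\int_{\Omega_1}\prod_i s_i(\omega)(B_i)\,dP(\omega)$$ for $\Omega_1\in\mathcal F$ and measurable $B_i\subseteq\mathcal A_i$; let $E_s$ be the corresponding expectation, $U_i(s)=E_s[R_i]$, and let $U_i(s\mid\mathcal F_i)=E_s[R_i\mid\mathcal F_i]$, viewed as an $\mathcal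 F_i$-measurable random variable on $\Omega$. For $\varepsilon\ge0$, a profile $s^*$ is a Harsanyi $\varepsilon$-equilibrium if $U_i(s_i,s^*_{-i})\le U_i(s^*)+\varepsilon$ for every player $i$ and every strategy $s_i$ of player $i$; it is a Bayesian $\varepsilon$-equilibrium if, for every player $i$ and every strategy $s_i$ of player $i$, $U_i(s_i,s^*_{-i}\mid\mathcal F_i)\le U_i(s^*\mid\mathcal F_i)+\varepsilon$ holds $P$-almost surely. (In both cases it is part of the requirement that $R_i$ is integrable with respect to $P_{(s_i,s^*_{-i})}$ for all $i$ and $s_i$, so that these payoffs are well defined.) Theorem. Consider a Bayesian game with nested information: $\mathcal F_n\subseteq\mathcal F_{n-1}\subseteq\dots\subseteq\mathcal F_1$. (1) Suppose that every $\mathcal A_i$ is a finite set and that there is a finite set $\mathcal R$ of payoff vectors, $\mathcal R\subseteq\mathbb R^{\{1,\dots,n\}\times\mathcal A}$, such that $(R_i(\omega,a))_{i,a}\in\mathcal R$ for $P$-almost every $\omega$. Then for every $\varepsilon>0$ the game admits a Bayesian $\varepsilon$-equilibrium. (2) Suppose that every $\mathcal A_i$ is a compact metric space with its Borel $\sigma$-field,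 that $a\mapsto R_i(\omega,a)$ is continuous on $\mathcal A$ (with the maximum metric) for every $i$ and $\omega$, and that $E\bigl[\max_{a\in\mathcal A}|R_i(a)|\bigr]<\infty$ for every $i$, where $R_i(a)$ denotes the random variable $\omega\mapsto R_i(\omega,a)$. Then for every $\varepsilon>0$ the game admits a Harsanyi $\varepsilon$-equilibrium. -/

import Mathlib

open MeasureTheory ProbabilityTheory

universe u v

/-- A Bayesian game with player set `Fin n`, state space `Ω` and action spaces `A i`:
a probability measure `P` on `Ω`, for every player a sub-σ-field `F i` of the σ-field of `Ω`
(her information) and a jointly measurable real payoff function on `Ω × ∏ i, A i`. -/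
structure BayesianGame (n : ℕ) (Ω : Type u) [MeasurableSpace Ω]
    (A : Fin n → Type v) [∀ i, MeasurableSpace (A i)] where
  P : Measure Ω
  isProbabilityMeasure_P : IsProbabilityMeasure P
  F : Fin n → MeasurableSpace Ω
  F_le : ∀ i, F i ≤ ‹MeasurableSpace Ω›
  nonempty_action : ∀ i, Nonempty (A i)
  R : Fin n → Ω × (∀ i, A i) → ℝ
  measurable_R : ∀ i, Measurable (R i)

namespace BayesianGame

variable {n : ℕ} {Ω : Type u} [mΩ : MeasurableSpace Ω]
  {A : Fin n → Type v} [∀ i, MeasurableSpace (A i)]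

/-- A behavior strategy of player `i`: an `F i`-measurable map from `Ω` to the probability
measures on `A i` (with the σ-field generated by the evaluations `μ ↦ μ B`, `B` measurable). -/
structure Strategy (Γ : BayesianGame n Ω A) (i : Fin n) where
  mixedAction : Ω → Measure (A i)
  isProbabilityMeasure_mixedAction : ∀ ω, IsProbabilityMeasure (mixedAction ω)
  measurable_mixedAction : Measurable[Γ.F i] mixedAction

attribute [instance] Strategy.isProbabilityMeasure_mixedAction

/-- Strategy profiles. -/
abbrev Profile (Γ : BayesianGame n Ω A) : Type (max u v) := ∀ i, Γ.Strategy i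

/-- At each state the players randomize independently: the kernel `ω ↦ ∏ i, s i ω`. -/
noncomputable def profileKernel (Γ : BayesianGame n Ω A) (s : Γ.Profile) :
    Kernel Ω (∀ i, A i) where
  toFun ω := Measure.pi fun i => (s i).mixedAction ω
  measurable' := by
    refine Measurable.measure_of_isPiSystem_of_isProbabilityMeasure generateFrom_pi.symm
      isPiSystem_pi ?_
    rintro _ ⟨B, hB, rfl⟩
    simp only [Measure.pi_pi]
    refine Finset.measurable_prod _ fun i _ => ?_
    exact (Measure.measurable_coe (hB i (Set.mem_univ i))).comp
      ((s i).measurable_mixedAction.mono (Γ.F_le i) le_rfl)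

instance isMarkovKernel_profileKernel (Γ : BayesianGame n Ω A) (s : Γ.Profile) :
    IsMarkovKernel (Γ.profileKernel s) :=
  ⟨fun ω => inferInstanceAs
    (IsProbabilityMeasure (Measure.pi fun i => (s i).mixedAction ω))⟩

/-- The distribution `P_s` on `Ω × ∏ i, A i` induced by the strategy profile `s`. -/
noncomputable def law (Γ : BayesianGame n Ω A) (s : Γ.Profile) : Measure (Ω × (∀ i, A i)) :=
  Γ.P ⊗ₘ Γ.profileKernel s

instance isProbabilityMeasure_law (Γ : BayesianGame n Ω A) (s : Γ.Profile) :
    IsProbabilityMeasure (Γ.law s) := by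
  have := Γ.isProbabilityMeasure_P
  unfold law
  infer_instance

/-- The formula that characterizes `P_s`. -/
theorem law_prod (Γ : BayesianGame n Ω A) (s : Γ.Profile) {Ω₁ : Set Ω} (hΩ : MeasurableSet Ω₁)
    {B : ∀ i, Set (A i)} (hB : ∀ i, MeasurableSet (B i)) :
    Γ.law s (Ω₁ ×ˢ Set.univ.pi B) = ∫⁻ ω in Ω₁, ∏ i, (s i).mixedAction ω (B i) ∂Γ.P := by
  have := Γ.isProbabilityMeasure_P
  rw [law, Measure.compProd_apply_prod hΩ (MeasurableSet.univ_pi hB)]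
  refine lintegral_congr fun ω => ?_
  exact Measure.pi_pi _ _

/-- The expected payoff `U_i(s) = E_s[R_i]`. -/
noncomputable def payoff (Γ : BayesianGame n Ω A) (s : Γ.Profile) (i : Fin n) : ℝ :=
  ∫ x, Γ.R i x ∂Γ.law s

/-- The information of player `i`, seen as a σ-field on `Ω × ∏ i, A i`. -/
abbrev infoProd (Γ : BayesianGame n Ω A) (i : Fin n) : MeasurableSpace (Ω × (∀ i, A i)) :=
  (Γ.F i).comap Prod.fst

/-- The conditional payoff `U_i(s ∣ F_i) = E_s[R_i ∣ F_i]`, as a function of the state. The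
conditional expectation is a function on `Ω × ∏ i, A i` that does not depend on the actions
(`condExp_eq_condPayoff`), so it is evaluated at an arbitrary action profile. -/
noncomputable def condPayoff (Γ : BayesianGame n Ω A) (s : Γ.Profile) (i : Fin n) (ω : Ω) : ℝ :=
  (Γ.law s)[Γ.R i | Γ.infoProd i] (ω, fun j => (Γ.nonempty_action j).some)

theorem condExp_eq_condPayoff (Γ : BayesianGame n Ω A) (s : Γ.Profile) (i : Fin n)
    (x : Ω × (∀ i, A i)) :
    (Γ.law s)[Γ.R i | Γ.infoProd i] x = Γ.condPayoff s i x.1 :=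
  StronglyMeasurable.factorsThrough (f := Prod.fst) (mY := Γ.F i)
    stronglyMeasurable_condExp rfl

/-- `s` is a Harsanyi `ε`-equilibrium: no player has a unilateral deviation that raises her
expected payoff by more than `ε` (all the expected payoffs involved being well defined). -/
def IsHarsanyiEquilibrium (Γ : BayesianGame n Ω A) (ε : ℝ) (s : Γ.Profile) : Prop :=
  ∀ (i : Fin n) (σ : Γ.Strategy i),
    Integrable (Γ.R i) (Γ.law (Function.update s i σ)) ∧
    Γ.payoff (Function.update s i σ) i ≤ Γ.payoff s i + ε

/-- `s` is a Bayesian `ε`-equilibrium: almost surely, no unilateral deviation of a player raises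
her conditional payoff given her information by more than `ε` (all the conditional payoffs
involved being well defined). -/
def IsBayesianEquilibrium (Γ : BayesianGame n Ω A) (ε : ℝ) (s : Γ.Profile) : Prop :=
  ∀ (i : Fin n) (σ : Γ.Strategy i),
    Integrable (Γ.R i) (Γ.law (Function.update s i σ)) ∧
    ∀ᵐ ω ∂Γ.P, Γ.condPayoff (Function.update s i σ) i ω ≤ Γ.condPayoff s i ω + ε

/-- Finite action sets, and a payoff vector that almost surely takes values in a finite set. -/
def FiniteActionsAndPayoffs (Γ : BayesianGame n Ω A) : Prop :=
  (∀ i, Finite (A i)) ∧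
  ∃ V : Set (Fin n → (∀ i, A i) → ℝ), V.Finite ∧
    ∀ᵐ ω ∂Γ.P, (fun i a => Γ.R i (ω, a)) ∈ V

/-- Compact metric action spaces (with their Borel σ-fields), payoffs that are continuous in the
action profile at every state, and `E[max_a |R_i(a)|] < ∞`. The product `∏ i, A i` carries the
maximum metric. -/
def IntegrableContinuousPayoffs [∀ i, MetricSpace (A i)] (Γ : BayesianGame n Ω A) : Prop :=
  (∀ i, CompactSpace (A i) ∧ BorelSpace (A i)) ∧
  (∀ i ω, Continuous fun a : (∀ i, A i) => Γ.R i (ω, a)) ∧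
  ∀ i, ∫⁻ ω, ⨆ a : (∀ i, A i), ‖Γ.R i (ω, a)‖ₑ ∂Γ.P < ⊤

/-- Nested information: `F_n ⊆ … ⊆ F_1`. -/
def NestedInformation (Γ : BayesianGame n Ω A) : Prop :=
  ∀ i j : Fin n, i ≤ j → Γ.F j ≤ Γ.F i

end BayesianGame

-- With finitely many signals, equilibria exist because every pair (player, type) can be made an
-- agent of a finite game. The difficulty is to replace the fields `F i` by finite ones, although a
-- player's beliefs involve the information of all the others. Nestedness resolves it. Starting from
-- a finite-valued payoff state, the best informed player rounds her conditional law of it to a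
-- finite grid, the next player rounds her conditional law of the pair (state, rounded belief), and
-- so on. The type of a player consists of her own rounded belief and of those of the less informed
-- players, which she knows; all the rest is described by her rounded belief
-- (`exists_finite_belief`, `exists_finite_typeSpace`).
--
-- An approximate Nash equilibrium of the resulting finite game (`exists_approx_nash`) is
-- approximately optimal on every event of `F i`, against all `F i`-measurable deviations
-- (`exists_finite_profile`). For finitely many payoff vectors this gives the Bayesian inequality
-- almost surely. For continuous payoffs, actions and payoffs are discretized first; that error is
-- small only in mean, so the conclusion is the ex ante one.
--
-- Brouwer's theorem is derived from the change of variables formula: for small `t`, `x + t (r x -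
-- x)` maps the ball bijectively onto itself, so its Jacobian integrates to the volume. The Jacobian
-- is polynomial in `t`, hence the same holds at `t = 1`, where a retraction `r` onto the sphere has
-- Jacobian zero.

universe w

/-! ### Brouwer's fixed point theorem for smooth maps. -/

open Polynomial in
/-- `t ↦ det (1 + t A)` is a polynomial of degree at most the dimension, so that its value at `1`
is a fixed linear combination of its values at sufficiently many nodes. -/
theorem exists_weights_det_one_add {E : Type*} [NormedAddCommGroup E] [NormedSpace ℝ E]
    [FiniteDimensional ℝ E] (v : ℕ → ℝ) (hv : Function.Injective v) :
    ∃ (s : Finset ℕ) (w : ℕ → ℝ), ∑ j ∈ s, w j = 1 ∧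
      ∀ A : E →L[ℝ] E, (1 + A).det = ∑ j ∈ s, w j * (1 + v j • A).det := by
  classical
  set d := Module.finrank ℝ E
  set s := Finset.range (d + 1)
  have hs : s.Nonempty := ⟨0, by simp [s]⟩
  refine ⟨s, fun j => (Lagrange.basis s v j).eval 1, ?_, fun A => ?_⟩
  · rw [← Polynomial.eval_finsetSum, Lagrange.sum_basis hv.injOn hs, Polynomial.eval_one]
  · let b := Module.finBasis ℝ E
    let M := LinearMap.toMatrix b b (A : E →ₗ[ℝ] E)
    let p : ℝ[X] := ((X : ℝ[X]) • M.map C + (1 : Matrix _ _ ℝ).map C).det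
    have hp : ∀ t : ℝ, p.eval t = (1 + t • A).det := by
      intro t
      have h1 : (1 + t • A).det = (1 + t • M).det := by
        rw [ContinuousLinearMap.det, ← LinearMap.det_toMatrix b]
        congr 1
        simp [M, map_add]
      rw [h1]
      simp only [p, ← Polynomial.coe_evalRingHom, RingHom.map_det]
      congr 1
      ext i j
      simp [Matrix.one_apply]
      split_ifs <;> simp <;> ring
    have hdeg : p.degree < s.card := by
      refine lt_of_le_of_lt Polynomial.degree_le_natDegree ?_
      have := Polynomial.natDegree_det_X_add_C_le M 1
      simp only [Fintype.card_fin] at this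
      simp only [s, Finset.card_range]
      exact_mod_cast Nat.lt_succ_of_le this
    have := Lagrange.eq_interpolate (f := p) hv.injOn hdeg
    have h1 : (1 + A).det = p.eval 1 := by rw [hp, one_smul]
    rw [h1, this, Lagrange.interpolate_apply, Polynomial.eval_finsetSum]
    refine Finset.sum_congr rfl fun j _ => ?_
    rw [Polynomial.eval_mul, Polynomial.eval_C, hp, mul_comm]

section

variable {E : Type*} [NormedAddCommGroup E] [InnerProductSpace ℝ E] [FiniteDimensional ℝ E]

/-- A kernel vector `v` of `1 + τ A` would satisfy `‖v‖ = τ ‖A v‖ ≤ t K ‖v‖ < ‖v‖`. So the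
determinant has no zero on `[0, t]`, and it equals `1` at `0`. -/
theorem det_one_add_smul_pos {A : E →L[ℝ] E} {K t : ℝ} (hA : ‖A‖ ≤ K) (ht : 0 ≤ t)
    (hK : t * K < 1) : 0 < (1 + t • A).det := by
  have hne : ∀ τ ∈ Set.Icc 0 t, (1 + τ • A).det ≠ 0 := by
    intro τ hτ h0
    obtain ⟨v, hv, hv0⟩ := (Submodule.ne_bot_iff _).1
      (LinearMap.bot_lt_ker_of_det_eq_zero (f := ((1 + τ • A : E →L[ℝ] E) : E →ₗ[ℝ] E)) h0).ne'
    have h1 : v + τ • A v = 0 := by simpa using hv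
    have h2 : ‖v‖ = τ * ‖A v‖ := by
      conv_lhs => rw [eq_neg_of_add_eq_zero_left h1]
      rw [norm_neg, norm_smul, Real.norm_of_nonneg hτ.1]
    have h3 : ‖A v‖ ≤ K * ‖v‖ := (A.le_opNorm v).trans (by gcongr)
    have h4 : 0 < ‖v‖ := norm_pos_iff.2 hv0
    have hK0 : 0 ≤ K := (norm_nonneg A).trans hA
    have : ‖v‖ ≤ (t * K) * ‖v‖ := by
      calc ‖v‖ = τ * ‖A v‖ := h2
        _ ≤ t * (K * ‖v‖) := by gcongr; exact hτ.2
        _ = _ := by ring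
    nlinarith
  by_contra hcon
  push Not at hcon
  have hcont : ContinuousOn (fun τ : ℝ => (1 + τ • A).det) (Set.Icc 0 t) := by
    refine Continuous.continuousOn ?_
    exact ContinuousLinearMap.continuous_det.comp (by fun_prop)
  have := intermediate_value_Icc' ht hcont
  obtain ⟨τ, hτ, h0⟩ := this (show (0 : ℝ) ∈ _ from ⟨hcon, by simp [ContinuousLinearMap.det]⟩)
  exact hne τ hτ h0

/-- A small Lipschitz perturbation of the identity of a ball that vanishes on the sphere surjects
onto the ball. -/
theorem exists_add_smul_eq {R t : ℝ} {K : NNReal} {h : E → E}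
    (hK : LipschitzOnWith K h (Metric.closedBall 0 R)) (h0 : ∀ x, ‖x‖ = R → h x = 0)
    (hR : 0 < R) (ht : 0 ≤ t) (htK : t * (2 * K) < 1) {y : E} (hy : y ∈ Metric.ball (0 : E) R) :
    ∃ x ∈ Metric.ball (0 : E) R, x + t • h x = y := by
  classical
  -- Extension by zero makes the contraction principle available on all of `E`. Comparing an inner
  -- with an outer point through the radial projection of the latter costs the factor 2.
  let H : E → E := fun x => if ‖x‖ ≤ R then h x else 0
  have hmix : ∀ x z : E, ‖x‖ ≤ R → R < ‖z‖ → ‖h x‖ ≤ 2 * K * ‖x - z‖ := by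
    intro x z hx hz
    have hz0 : 0 < ‖z‖ := hR.trans hz
    let p := (R / ‖z‖) • z
    have hp : ‖p‖ = R := by
      simp only [p, norm_smul, Real.norm_of_nonneg (div_nonneg hR.le hz0.le)]
      field_simp
    have h1 : ‖h x‖ ≤ K * ‖x - p‖ := by
      have := hK.norm_sub_le (x := x) (y := p) (by simpa using hx) (by simp [hp])
      rwa [h0 p hp, sub_zero] at this
    have h2 : ‖z - p‖ = ‖z‖ - R := by
      have : z - p = (1 - R / ‖z‖) • z := by simp [p, sub_smul]
      rw [this, norm_smul, Real.norm_of_nonneg]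
      · field_simp
      · rw [sub_nonneg, div_le_one hz0]; exact hz.le
    have h3 : ‖x - p‖ ≤ ‖x - z‖ + ‖z - p‖ := norm_sub_le_norm_sub_add_norm_sub x z p
    have h4 : ‖z‖ - ‖x‖ ≤ ‖x - z‖ := by rw [norm_sub_rev]; exact norm_sub_norm_le z x
    calc ‖h x‖ ≤ K * ‖x - p‖ := h1
      _ ≤ K * (2 * ‖x - z‖) := by gcongr; linarith
      _ = _ := by ring
  have hH : ∀ x z, ‖H x - H z‖ ≤ 2 * K * ‖x - z‖ := by
    intro x z
    by_cases hx : ‖x‖ ≤ R <;> by_cases hz : ‖z‖ ≤ R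
    · simp only [H, hx, hz, if_true]
      refine (hK.norm_sub_le (by simpa using hx) (by simpa using hz)).trans ?_
      have : 0 ≤ (K : ℝ) * ‖x - z‖ := by positivity
      linarith
    · simp only [H, hx, hz, if_true, if_false, sub_zero]
      exact hmix x z hx (not_le.1 hz)
    · simp only [H, hx, hz, if_true, if_false, zero_sub, norm_neg]
      rw [norm_sub_rev]
      exact hmix z x hz (not_le.1 hx)
    · simp only [H, hx, hz, if_false, sub_zero, norm_zero]
      positivity
  have hc : ContractingWith (t * (2 * K)).toNNReal (fun x => y - t • H x) := by
    refine ⟨by rwa [← NNReal.coe_lt_coe, Real.coe_toNNReal _ (by positivity)], LipschitzWith.of_dist_le_mul fun x z => ?_⟩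
    rw [dist_eq_norm, dist_eq_norm]
    have : y - t • H x - (y - t • H z) = t • (H z - H x) := by rw [smul_sub]; abel
    rw [this, norm_smul, Real.norm_of_nonneg ht, norm_sub_rev]
    calc t * ‖H x - H z‖ ≤ t * (2 * K * ‖x - z‖) := by gcongr; exact hH x z
      _ = _ := by rw [Real.coe_toNNReal _ (by positivity)]; ring
  have hfix : y - t • H (ContractingWith.fixedPoint _ hc) = ContractingWith.fixedPoint _ hc :=
    hc.fixedPoint_isFixedPt
  set x := ContractingWith.fixedPoint _ hc
  have hxy : x + t • H x = y := (eq_sub_iff_add_eq.1 hfix.symm)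
  have hx : ‖x‖ < R := by
    by_contra hcon
    have : H x = 0 := by
      by_cases hx : ‖x‖ ≤ R
      · simp only [H, hx, if_true]; exact h0 x (le_antisymm hx (not_lt.1 hcon))
      · simp [H, hx]
    rw [this, smul_zero, add_zero] at hxy
    rw [hxy] at hcon
    exact hcon (by simpa using hy)
  refine ⟨x, by simpa using hx, ?_⟩
  simpa [H, hx.le] using hxy

/-- There is no `C^1` retraction of a closed ball onto its boundary sphere. -/
theorem no_retraction {R : ℝ} (hR : 0 < R) {r : E → E}
    (hr : ∀ x ∈ Metric.closedBall (0 : E) R, ContDiffAt ℝ 1 r x)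
    (hmap : ∀ x ∈ Metric.closedBall (0 : E) R, ‖r x‖ = R) (hid : ∀ x, ‖x‖ = R → r x = x) :
    False := by
  borelize E
  let h : E → E := fun x => r x - x
  have hcd : ∀ x ∈ Metric.closedBall (0 : E) R, ContDiffAt ℝ 1 h x :=
    fun x hx => (hr x hx).sub contDiffAt_id
  obtain ⟨K, hK⟩ : ∃ K, LipschitzOnWith K h (Metric.closedBall 0 R) := by
    have : ContDiffOn ℝ 1 h (Metric.closedBall 0 R) := fun x hx => (hcd x hx).contDiffWithinAt
    exact this.exists_lipschitzOnWith one_ne_zero (convex_closedBall _ _) (isCompact_closedBall _ _)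
  have hd : ∀ x ∈ Metric.ball (0 : E) R, HasFDerivAt h (fderiv ℝ h x) x := fun x hx =>
    ((hcd x (Metric.ball_subset_closedBall hx)).differentiableAt one_ne_zero).hasFDerivAt
  have hdK : ∀ x ∈ Metric.ball (0 : E) R, ‖fderiv ℝ h x‖ ≤ K := fun x hx =>
    (hd x hx).le_of_lipschitzOn (Metric.closedBall_mem_nhds_of_mem hx) hK
  -- Infinitely many distinct nodes, so small that `x + t j • h x` has positive Jacobian, is
  -- injective, maps the ball into itself (`t j < 1`, a convex combination of `x` and `r x`) and is
  -- onto.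
  let t : ℕ → ℝ := fun j => 1 / ((2 * K + 2) * (j + 1))
  have ht0 : ∀ j, 0 < t j := fun j => by positivity
  have ht1 : ∀ j, t j ≤ 1 / (2 * K + 2) := by
    intro j
    refine one_div_le_one_div_of_le (by positivity) ?_
    have : (1 : ℝ) ≤ j + 1 := by linarith [(Nat.cast_nonneg j : (0 : ℝ) ≤ j)]
    exact le_mul_of_one_le_right (by positivity) this
  have htlt : ∀ j, t j < 1 := fun j => (ht1 j).trans_lt (by
    rw [div_lt_one (by positivity)]; linarith [K.2])
  have htK : ∀ j, t j * (2 * K) < 1 := by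
    intro j
    calc t j * (2 * K) ≤ 1 / (2 * K + 2) * (2 * K) := by gcongr; exact ht1 j
      _ < 1 := by rw [one_div_mul_eq_div, div_lt_one (by positivity)]; linarith
  have htinj : Function.Injective t := by
    intro a b hab
    have h1 : ((2 * K + 2 : ℝ) * (a + 1)) = (2 * K + 2) * (b + 1) := by
      simpa [t] using hab
    have h2 := mul_left_cancel₀ (by positivity : (2 * K + 2 : ℝ) ≠ 0) h1
    exact_mod_cast add_right_cancel h2
  obtain ⟨s, w, hw1, hw⟩ := exists_weights_det_one_add (E := E) t htinj
  have hpos : ∀ j, ∀ x ∈ Metric.ball (0 : E) R, 0 < (1 + t j • fderiv ℝ h x).det :=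
    fun j x hx => det_one_add_smul_pos (hdK x hx) (ht0 j).le (by
      have := htK j
      have : 0 ≤ t j * K := mul_nonneg (ht0 j).le K.2
      linarith)
  have hder : ∀ j, ∀ x ∈ Metric.ball (0 : E) R,
      HasFDerivWithinAt (fun x => x + t j • h x) (1 + t j • fderiv ℝ h x) (Metric.ball 0 R) x :=
    fun j x hx => ((hasFDerivAt_id x).add ((hd x hx).const_smul (t j))).hasFDerivWithinAt
  have hinj : ∀ j, Set.InjOn (fun x => x + t j • h x) (Metric.ball (0 : E) R) := by
    intro j x hx y hy hxy
    have h1 : x - y = t j • (h y - h x) := by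
      simp only at hxy
      rw [smul_sub, sub_eq_sub_iff_add_eq_add, hxy, add_comm]
    have h2 : ‖x - y‖ ≤ t j * (K * ‖x - y‖) := by
      conv_lhs => rw [h1, norm_smul, Real.norm_of_nonneg (ht0 j).le, norm_sub_rev]
      have := hK.norm_sub_le (Metric.ball_subset_closedBall hx) (Metric.ball_subset_closedBall hy)
      exact mul_le_mul_of_nonneg_left this (ht0 j).le
    by_contra hne
    have h3 : 0 < ‖x - y‖ := norm_pos_iff.2 (sub_ne_zero.2 hne)
    have : 0 ≤ t j * K := mul_nonneg (ht0 j).le K.2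
    nlinarith [htK j]
  have himg : ∀ j, (fun x => x + t j • h x) '' Metric.ball (0 : E) R = Metric.ball 0 R := by
    intro j
    refine Set.Subset.antisymm ?_ ?_
    · rintro _ ⟨x, hx, rfl⟩
      have hx' : ‖x‖ < R := by simpa using hx
      have : x + t j • h x = (1 - t j) • x + t j • r x := by
        simp only [h, smul_sub, sub_smul, one_smul]; abel
      simp only [this, mem_ball_zero_iff]
      refine (norm_add_le _ _).trans_lt ?_
      rw [norm_smul, norm_smul, Real.norm_of_nonneg (ht0 j).le,
        Real.norm_of_nonneg (sub_nonneg.2 (htlt j).le), hmap x (Metric.ball_subset_closedBall hx)]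
      nlinarith [htlt j, ht0 j]
    · intro y hy
      exact exists_add_smul_eq hK (fun x hx => by simp [h, hid x hx]) hR (ht0 j).le (htK j) hy
  -- Change of variables: the map is a bijection of the ball, so its Jacobian integrates to the
  -- volume.
  have hint : ∀ j, IntegrableOn (fun x => (1 + t j • fderiv ℝ h x).det) (Metric.ball (0 : E) R)
      (volume : Measure E) ∧
      ∫ x in Metric.ball (0 : E) R, (1 + t j • fderiv ℝ h x).det =
        (volume : Measure E).real (Metric.ball 0 R) := by
    intro j
    have habs : Set.EqOn (fun x => |(1 + t j • fderiv ℝ h x).det| • (1 : ℝ))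
        (fun x => (1 + t j • fderiv ℝ h x).det) (Metric.ball (0 : E) R) := fun x hx => by
      simp [abs_of_pos (hpos j x hx)]
    have h1 := integrableOn_image_iff_integrableOn_abs_det_fderiv_smul (volume : Measure E)
      measurableSet_ball (hder j) (hinj j) (fun _ => (1 : ℝ))
    have h2 := integral_image_eq_integral_abs_det_fderiv_smul (volume : Measure E)
      measurableSet_ball (hder j) (hinj j) (fun _ => (1 : ℝ))
    rw [himg] at h1 h2
    refine ⟨(h1.1 ?_).congr_fun habs measurableSet_ball, ?_⟩
    · exact integrableOn_const (measure_ball_lt_top.ne)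
    · rw [← setIntegral_congr_fun measurableSet_ball habs, ← h2]
      simp
  -- As `‖r‖` is constant, the range of the derivative of `r` at `x` is orthogonal to `r x ≠ 0`; an
  -- invertible derivative would have `r x` in its range.
  have hzero : ∀ x ∈ Metric.ball (0 : E) R, (1 + fderiv ℝ h x).det = 0 := by
    intro x hx
    have hrd : HasFDerivAt r (1 + fderiv ℝ h x) x := by
      have := (hasFDerivAt_id x).add (hd x hx)
      refine this.congr_of_eventuallyEq (Filter.Eventually.of_forall fun y => ?_)
      simp [h]
    have h1 : HasFDerivAt (fun y => inner ℝ (r y) (r y)) (0 : E →L[ℝ] ℝ) x := by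
      refine (hasFDerivAt_const (R ^ 2) x).congr_of_eventuallyEq ?_
      filter_upwards [Metric.isOpen_ball.mem_nhds hx] with y hy
      rw [real_inner_self_eq_norm_sq, hmap y (Metric.ball_subset_closedBall hy)]
    have h2 := h1.unique (hrd.inner ℝ hrd)
    by_contra hdet
    have hsurj : Function.Surjective (1 + fderiv ℝ h x : E →L[ℝ] E) := by
      exact (LinearMap.equivOfDetNeZero ((1 + fderiv ℝ h x : E →L[ℝ] E) : E →ₗ[ℝ] E)
        hdet).surjective
    obtain ⟨v, hv⟩ := hsurj (r x)
    have h3 := congrArg (fun L => L v) h2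
    simp only [ContinuousLinearMap.comp_apply, ContinuousLinearMap.prod_apply,
      fderivInnerCLM_apply, hv, real_inner_self_eq_norm_sq,
      hmap x (Metric.ball_subset_closedBall hx), zero_apply] at h3
    nlinarith
  -- Interpolation carries the value of the integral from the small nodes to `t = 1`, since the
  -- weights sum to one.
  have hfin : ∫ x in Metric.ball (0 : E) R, (1 + fderiv ℝ h x).det =
      (volume : Measure E).real (Metric.ball 0 R) := by
    rw [setIntegral_congr_fun measurableSet_ball (fun x _ => hw (fderiv ℝ h x)), integral_finsetSum _ fun j _ => (hint j).1.const_mul (w j)]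
    simp_rw [integral_const_mul, (hint _).2, ← Finset.sum_mul, hw1, one_mul]
  rw [setIntegral_congr_fun measurableSet_ball hzero] at hfin
  have : 0 < (volume : Measure E).real (Metric.ball (0 : E) R) :=
    ENNReal.toReal_pos (Metric.measure_ball_pos _ _ hR).ne' measure_ball_lt_top.ne
  simp at hfin
  exact this.ne hfin

/-- Brouwer's fixed point theorem for bounded `C^1` self-maps of a Euclidean space. -/
theorem exists_fixedPoint_of_contDiff {f : E → E} (hf : ContDiff ℝ 1 f) {M : ℝ}
    (hM : ∀ x, ‖f x‖ ≤ M) : ∃ x, f x = x := by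
  by_contra! hne
  have hM0 : 0 ≤ M := (norm_nonneg _).trans (hM 0)
  -- A radius strictly above the bound of `f` makes `b` positive on the sphere.
  let R := M + 1
  have hR : 0 < R := by positivity
  let u : E → E := fun x => x - f x
  have hu : ∀ x, 0 < ‖u x‖ ^ 2 := fun x => by
    have : 0 < ‖u x‖ := norm_pos_iff.2 (sub_ne_zero.2 (hne x).symm)
    positivity
  have hucd : ContDiff ℝ 1 u := contDiff_id.sub hf
  let b : E → ℝ := fun x => inner ℝ x (u x)
  let D : E → ℝ := fun x => b x ^ 2 + ‖u x‖ ^ 2 * (R ^ 2 - ‖x‖ ^ 2)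
  have hDpos : ∀ x ∈ Metric.closedBall (0 : E) R, 0 < D x := by
    intro x hx
    have hx' : ‖x‖ ≤ R := by simpa using hx
    rcases hx'.lt_or_eq with h | h
    · have : 0 < ‖u x‖ ^ 2 * (R ^ 2 - ‖x‖ ^ 2) :=
        mul_pos (hu x) (by nlinarith [norm_nonneg x])
      have := sq_nonneg (b x)
      simp only [D]; linarith
    · have h1 : 0 < b x := by
        simp only [b, u, inner_sub_right, real_inner_self_eq_norm_sq, h]
        have := real_inner_le_norm x (f x)
        rw [h] at this
        have : R * ‖f x‖ ≤ R * M := by gcongr; exact hM x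
        nlinarith
      simp only [D, h]; nlinarith
  -- The larger root of `‖x + τ u x‖ = R`: the retraction sends `x` to the point where the ray from
  -- `f x` through `x` leaves the ball. The reduced discriminant `D` is positive on the closed ball,
  -- so the root is smooth there.
  let τ : E → ℝ := fun x => (-b x + Real.sqrt (D x)) / ‖u x‖ ^ 2
  have hbcd : ContDiff ℝ 1 b := contDiff_id.inner ℝ hucd
  have hncd : ContDiff ℝ 1 fun x => ‖u x‖ ^ 2 := hucd.norm_sq ℝ
  have hDcd : ContDiff ℝ 1 D :=
    (hbcd.pow 2).add (hncd.mul (contDiff_const.sub (contDiff_id.norm_sq ℝ)))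
  have hkey : ∀ x ∈ Metric.closedBall (0 : E) R,
      ‖u x‖ ^ 2 * τ x ^ 2 + 2 * b x * τ x = R ^ 2 - ‖x‖ ^ 2 := by
    intro x hx
    have h1 := Real.sq_sqrt (hDpos x hx).le
    have h2 := (hu x).ne'
    have h3 : ‖u x‖ ^ 2 * τ x = -b x + Real.sqrt (D x) := by
      exact mul_div_cancel₀ _ h2
    have h4 : ‖u x‖ ^ 2 * (‖u x‖ ^ 2 * τ x ^ 2 + 2 * b x * τ x) =
        ‖u x‖ ^ 2 * (R ^ 2 - ‖x‖ ^ 2) := by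
      calc _ = (‖u x‖ ^ 2 * τ x) ^ 2 + 2 * b x * (‖u x‖ ^ 2 * τ x) := by ring
        _ = Real.sqrt (D x) ^ 2 - b x ^ 2 := by rw [h3]; ring
        _ = _ := by rw [h1]; simp only [D]; ring
    exact mul_left_cancel₀ h2 h4
  refine no_retraction hR (r := fun x => x + τ x • u x) ?_ ?_ ?_
  · intro x hx
    refine contDiffAt_id.add (ContDiffAt.smul ?_ hucd.contDiffAt)
    refine ContDiffAt.div ?_ hncd.contDiffAt (hu x).ne'
    exact hbcd.neg.contDiffAt.add (hDcd.contDiffAt.sqrt (hDpos x hx).ne')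
  · intro x hx
    have h1 : ‖x + τ x • u x‖ ^ 2 = R ^ 2 := by
      rw [norm_add_sq_real, inner_smul_right, norm_smul, mul_pow, Real.norm_eq_abs, sq_abs]
      have := hkey x hx
      simp only [b] at this
      linarith
    exact (pow_left_inj₀ (norm_nonneg _) hR.le two_ne_zero).1 h1
  · intro x hx
    have hb : 0 ≤ b x := by
      simp only [b, u, inner_sub_right, real_inner_self_eq_norm_sq, hx]
      have := real_inner_le_norm x (f x)
      rw [hx] at this
      have : R * ‖f x‖ ≤ R * M := by gcongr; exact hM x
      nlinarith
    have : τ x = 0 := by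
      simp [τ, D, hx, Real.sqrt_sq hb]
    simp [this]

end

/-! ### Approximate Nash equilibria of finite games. -/

/-- An action worse than `a` by `d` has weight at most `exp (-l d)`, and `d exp (-l d) ≤ 1 / l`. The
softmax is thus a smooth substitute for the best-reply correspondence, to which Brouwer's theorem
for maps applies. -/
theorem le_sum_softmax_mul {K : Type*} [Fintype K] [Nonempty K] (g : K → ℝ) {l : ℝ} (hl : 0 < l)
    (a : K) :
    g a ≤ ∑ b, Real.exp (l * g b) / (∑ c, Real.exp (l * g c)) * g b + Fintype.card K / l := by
  set Z := ∑ c, Real.exp (l * g c)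
  have hZ : 0 < Z := Finset.sum_pos (fun _ _ => Real.exp_pos _) Finset.univ_nonempty
  have hterm : ∀ b, Real.exp (l * g b) / Z * (g a - g b) ≤ 1 / l := by
    intro b
    rcases le_total (g a) (g b) with h | h
    · exact (mul_nonpos_of_nonneg_of_nonpos (by positivity) (by linarith)).trans (by positivity)
    · have h1 : Real.exp (l * g b) / Z ≤ Real.exp (l * g b) / Real.exp (l * g a) := by
        gcongr
        exact Finset.single_le_sum (f := fun c => Real.exp (l * g c))
          (fun _ _ => (Real.exp_pos _).le) (Finset.mem_univ a)
      have h2 : l * (g a - g b) ≤ Real.exp (l * (g a - g b)) := by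
        linarith [Real.add_one_le_exp (l * (g a - g b))]
      calc Real.exp (l * g b) / Z * (g a - g b)
          ≤ Real.exp (l * g b) / Real.exp (l * g a) * (g a - g b) :=
            mul_le_mul_of_nonneg_right h1 (by linarith)
        _ = (g a - g b) / Real.exp (l * (g a - g b)) := by
            rw [mul_sub l, Real.exp_sub]; field_simp
        _ ≤ 1 / l := by
            rw [div_le_div_iff₀ (Real.exp_pos _) hl]; linarith
  have hsum : ∑ b, Real.exp (l * g b) / Z = 1 := by
    rw [← Finset.sum_div]; exact div_self hZ.ne'
  have h1 : ∑ b, Real.exp (l * g b) / Z * (g a - g b) ≤ Fintype.card K / l := by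
    refine (Finset.sum_le_sum fun b _ => hterm b).trans ?_
    simp [div_eq_mul_inv]
  simp_rw [mul_sub, Finset.sum_sub_distrib, ← Finset.sum_mul, hsum, one_mul] at h1
  linarith

/-- Approximate Nash equilibria of games in which each player chooses a point of a simplex and
best replies are taken against continuously differentiable payoffs. -/
theorem exists_approx_nash {P : Type*} [Fintype P] {K : P → Type*} [∀ p, Fintype (K p)]
    [∀ p, Nonempty (K p)] (g : ∀ p, K p → (∀ p, K p → ℝ) → ℝ)
    (hg : ∀ p a, ContDiff ℝ 1 (g p a)) {ε : ℝ} (hε : 0 < ε) :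
    ∃ x : ∀ p, K p → ℝ, (∀ p a, 0 ≤ x p a) ∧ (∀ p, ∑ a, x p a = 1) ∧
      ∀ p a, g p a x ≤ ∑ b, x p b * g p b x + ε := by
  obtain ⟨l, hl, hlε⟩ : ∃ l : ℝ, 0 < l ∧ ∀ p, (Fintype.card (K p) : ℝ) / l ≤ ε := by
    -- The summand `1` keeps `l` positive even when there are no agents.
    refine ⟨(∑ p, (Fintype.card (K p) : ℝ) + 1) / ε, by positivity, fun p => ?_⟩
    rw [div_div_eq_mul_div, div_le_iff₀ (by positivity), mul_comm]
    gcongr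
    have := Finset.single_le_sum (f := fun p => (Fintype.card (K p) : ℝ))
      (fun _ _ => Nat.cast_nonneg _) (Finset.mem_univ p)
    linarith
  let E := EuclideanSpace ℝ (Σ p, K p)
  let c : E → ∀ p, K p → ℝ := fun z p a => z ⟨p, a⟩
  have hc : ContDiff ℝ 1 c := contDiff_pi.2 fun p => contDiff_pi.2 fun a =>
    contDiff_euclidean.1 (contDiff_id (E := E)) (⟨p, a⟩ : Σ p, K p)
  let e : E → ∀ p, K p → ℝ := fun z p a => Real.exp (l * g p a (c z))
  have he : ∀ p a, ContDiff ℝ 1 fun z => e z p a := fun p a =>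
    (contDiff_const.mul ((hg p a).comp hc)).exp
  have hZ : ∀ z p, 0 < ∑ b, e z p b := fun z p =>
    Finset.sum_pos (fun _ _ => Real.exp_pos _) Finset.univ_nonempty
  -- Defined on the whole Euclidean space but with values in the product of simplices, so a fixed
  -- point is automatically a mixed profile.
  let f : E → E := fun z => WithLp.toLp 2 fun q => e z q.1 q.2 / ∑ b, e z q.1 b
  have hf : ContDiff ℝ 1 f := by
    refine contDiff_euclidean.2 fun q => ?_
    exact (he _ _).div (ContDiff.sum fun b _ => he _ _) fun z => (hZ z _).ne'
  have hle : ∀ z q, |f z q| ≤ 1 := by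
    intro z q
    have h0 : 0 ≤ f z q := div_nonneg (Real.exp_pos _).le (hZ z _).le
    rw [abs_of_nonneg h0]
    refine (div_le_one (hZ z _)).2 ?_
    exact Finset.single_le_sum (f := fun b => e z q.1 b)
      (fun _ _ => (Real.exp_pos _).le) (Finset.mem_univ q.2)
  obtain ⟨z, hz⟩ := exists_fixedPoint_of_contDiff hf
    (M := Real.sqrt (Fintype.card (Σ p, K p))) fun z => by
      rw [EuclideanSpace.norm_eq]
      refine Real.sqrt_le_sqrt ?_
      refine (Finset.sum_le_sum (g := fun _ => (1 : ℝ)) fun q _ => ?_).trans (by simp)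
      exact pow_le_one₀ (norm_nonneg _) (hle z q)
  have hcz : ∀ p a, c z p a = e z p a / ∑ b, e z p b := fun p a => by
    conv_lhs => simp only [c]; rw [← hz]
  refine ⟨c z, fun p a => ?_, fun p => ?_, fun p a => ?_⟩
  · rw [hcz]; exact div_nonneg (Real.exp_pos _).le (hZ z _).le
  · simp_rw [hcz, ← Finset.sum_div]; exact div_self (hZ z p).ne'
  · have := le_sum_softmax_mul (fun b => g p b (c z)) hl a
    simp_rw [hcz p]
    simp only [e]
    linarith [hlε p]

/-! ### Finite approximation of beliefs under nested information. -/

/-- Finite type spaces carry no σ-field; measurable fibres take its place, so that the same variable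
can be tested against any sub-σ-field of `Ω`. -/
theorem measurable_comp_of_preimage_singleton {Ω T β : Type*} {m : MeasurableSpace Ω}
    [MeasurableSpace β] [Finite T] {q : Ω → T} (hq : ∀ t, MeasurableSet (q ⁻¹' {t})) (f : T → β) :
    Measurable fun ω => f (q ω) := by
  intro B _
  have : (fun ω => f (q ω)) ⁻¹' B = ⋃ t ∈ f ⁻¹' B, q ⁻¹' {t} := by ext; simp
  rw [this]
  exact (Set.toFinite _).measurableSet_biUnion fun t _ => hq t

theorem integrable_comp_of_preimage_singleton {Ω T : Type*} {m : MeasurableSpace Ω}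
    {P : Measure Ω} [IsFiniteMeasure P] [Finite T] {q : Ω → T}
    (hq : ∀ t, MeasurableSet (q ⁻¹' {t})) (f : T → ℝ) : Integrable (fun ω => f (q ω)) P := by
  obtain ⟨M, hM⟩ := (Set.finite_range fun t => ‖f t‖).bddAbove
  exact Integrable.of_bound (measurable_comp_of_preimage_singleton hq f).aestronglyMeasurable M
    (Filter.Eventually.of_forall fun ω => hM ⟨q ω, rfl⟩)

/-- Discretization of a conditional distribution: the conditional law of a finite-valued variable
`q` given `G` is uniformly close to a function of a finite-valued `G`-measurable variable `Y`. -/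
theorem exists_finite_belief {Ω : Type*} {G mΩ : MeasurableSpace Ω} (P : Measure Ω)
    [IsProbabilityMeasure P] (hG : G ≤ mΩ) {T : Type w} [Fintype T]
    {q : Ω → T} (hq : ∀ t, MeasurableSet (q ⁻¹' {t})) {δ : ℝ} (hδ : 0 < δ) :
    ∃ (S : Type w) (_ : Fintype S) (Y : Ω → S) (b : S → T → ℝ),
      (∀ y, MeasurableSet[G] (Y ⁻¹' {y})) ∧
      ∀ w : Ω → ℝ, Measurable[G] w → (∀ ω, |w ω| ≤ 1) → ∀ (f : T → ℝ) (M : ℝ),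
        (∀ t, |f t| ≤ M) →
        |∫ ω, w ω * (f (q ω) - ∑ t, b (Y ω) t * f t) ∂P| ≤ δ * M * ∫ ω, |w ω| ∂P := by
  classical
  -- Each of the `card T` conditional probabilities will be off by at most `1 / N`.
  obtain ⟨N, hN0, hN⟩ : ∃ N : ℕ, 0 < N ∧ (Fintype.card T : ℝ) / N ≤ δ := by
    obtain ⟨N, hN⟩ := exists_nat_gt ((Fintype.card T : ℝ) / δ)
    have h0 : (0 : ℝ) < N := lt_of_le_of_lt (by positivity) hN
    refine ⟨N, by exact_mod_cast h0, ?_⟩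
    rw [div_lt_iff₀ hδ] at hN
    rw [div_le_iff₀ h0]; linarith
  have hN0' : (0 : ℝ) < N := by exact_mod_cast hN0
  let I : T → Ω → ℝ := fun t => (q ⁻¹' {t}).indicator fun _ => 1
  have hImeas : ∀ t, Measurable (I t) := fun t => measurable_const.indicator (hq t)
  have hI0 : ∀ t ω, 0 ≤ I t ω := fun t ω => Set.indicator_nonneg (fun _ _ => zero_le_one) ω
  have hI1 : ∀ t ω, I t ω ≤ 1 := fun t ω =>
    Set.indicator_le_self' (f := fun _ => (1 : ℝ)) (fun _ _ => zero_le_one) ω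
  have hIint : ∀ t, Integrable (I t) P := fun t =>
    (integrable_const (1 : ℝ)).indicator (hq t)
  let p : T → Ω → ℝ := fun t => P[I t | G]
  have hpm : ∀ t, StronglyMeasurable[G] (p t) := fun t => stronglyMeasurable_condExp
  have hp0 : ∀ t, ∀ᵐ ω ∂P, 0 ≤ p t ω := fun t =>
    condExp_nonneg (Filter.Eventually.of_forall (hI0 t))
  have hp1 : ∀ t, ∀ᵐ ω ∂P, p t ω ≤ 1 := fun t => by
    have := condExp_mono (m := G) (hIint t) (integrable_const (1 : ℝ))
      (Filter.Eventually.of_forall (hI1 t))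
    rwa [condExp_const hG] at this
  -- The vector of conditional probabilities rounded down to multiples of `1 / N`. The cap `min N`
  -- acts only on the null set where a version exceeds one.
  let Y : Ω → T → Fin (N + 1) := fun ω t =>
    ⟨min N ⌊N * p t ω⌋₊, Nat.lt_succ_of_le (min_le_left _ _)⟩
  let b : (T → Fin (N + 1)) → T → ℝ := fun y t => (y t : ℕ) / N
  have hYm : ∀ y, MeasurableSet[G] (Y ⁻¹' {y}) := by
    intro y
    have : Y ⁻¹' {y} = ⋂ t, (fun ω => min N ⌊N * p t ω⌋₊) ⁻¹' {(y t : ℕ)} := by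
      ext ω; simp [Y, funext_iff, Fin.ext_iff]
    rw [this]
    refine MeasurableSet.iInter fun t => ?_
    have : Measurable[G] fun ω => min N ⌊N * p t ω⌋₊ :=
      (measurable_from_top (f := fun k : ℕ => min N k)).comp
        (Nat.measurable_floor.comp ((hpm t).measurable.const_mul (N : ℝ)))
    exact this (measurableSet_singleton _)
  refine ⟨T → Fin (N + 1), inferInstance, Y, b, hYm, fun w hw hw1 f M hf => ?_⟩
  have hwm : Measurable w := hw.mono hG le_rfl
  have hwint : Integrable w P :=
    Integrable.of_bound hwm.aestronglyMeasurable 1 (Filter.Eventually.of_forall hw1)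
  have hbm : ∀ t, Measurable fun ω => b (Y ω) t := fun t =>
    measurable_comp_of_preimage_singleton (fun y => hG _ (hYm y)) fun y => b y t
  have hb0 : ∀ y t, 0 ≤ b y t := fun y t => by positivity
  have hb1 : ∀ y t, b y t ≤ 1 := fun y t => by
    rw [div_le_one hN0']
    exact_mod_cast Nat.lt_succ_iff.1 (y t).2
  have hbp : ∀ t, ∀ᵐ ω ∂P, |p t ω - b (Y ω) t| ≤ 1 / N := by
    intro t
    filter_upwards [hp0 t, hp1 t] with ω h0 h1
    have h2 : ⌊N * p t ω⌋₊ ≤ N := by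
      refine Nat.floor_le_of_le ?_
      nlinarith
    have h3 : b (Y ω) t = ⌊N * p t ω⌋₊ / N := by simp [b, Y, h2]
    rw [h3, abs_le]
    have h4 := Nat.floor_le (mul_nonneg hN0'.le h0)
    have h5 := Nat.lt_floor_add_one (N * p t ω)
    constructor
    · have : 0 ≤ (p t ω - ⌊N * p t ω⌋₊ / N) := by
        rw [sub_nonneg, div_le_iff₀ hN0']; linarith
      have : (0 : ℝ) ≤ 1 / N := by positivity
      linarith
    · rw [sub_le_iff_le_add, ← add_div, le_div_iff₀ hN0']; linarith
  have hwI : ∀ t, Integrable (fun ω => w ω * I t ω) P := fun t =>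
    (hIint t).bdd_mul hwm.aestronglyMeasurable (c := 1) (Filter.Eventually.of_forall hw1)
  have hwp : ∀ t, Integrable (fun ω => w ω * p t ω) P := fun t =>
    integrable_condExp.bdd_mul hwm.aestronglyMeasurable (c := 1) (Filter.Eventually.of_forall hw1)
  have hwb : ∀ t, Integrable (fun ω => w ω * b (Y ω) t) P := fun t => by
    refine hwint.mul_bdd (c := 1) (hbm t).aestronglyMeasurable
      (Filter.Eventually.of_forall fun ω => ?_)
    rw [Real.norm_of_nonneg (hb0 _ _)]; exact hb1 _ _
  -- A `G`-measurable weight cannot distinguish an indicator from its conditional expectation; this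
  -- is why the estimate is stated with test functions `w`.
  have hcond : ∀ t, ∫ ω, w ω * I t ω ∂P = ∫ ω, w ω * p t ω ∂P := by
    intro t
    rw [← integral_condExp hG]
    exact integral_congr_ae
      (condExp_mul_of_stronglyMeasurable_left hw.stronglyMeasurable (hwI t) (hIint t))
  have hone : ∀ t, |∫ ω, w ω * (I t ω - b (Y ω) t) ∂P| ≤ 1 / N * ∫ ω, |w ω| ∂P := by
    intro t
    have : ∫ ω, w ω * (I t ω - b (Y ω) t) ∂P = ∫ ω, w ω * (p t ω - b (Y ω) t) ∂P := by
      simp_rw [mul_sub]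
      rw [integral_sub (hwI t) (hwb t), integral_sub (hwp t) (hwb t), hcond]
    rw [this, ← integral_const_mul, ← Real.norm_eq_abs]
    refine norm_integral_le_of_norm_le (hwint.abs.const_mul _) ?_
    filter_upwards [hbp t] with ω h
    rw [norm_mul, mul_comm, Real.norm_eq_abs, Real.norm_eq_abs]
    exact mul_le_mul_of_nonneg_right h (abs_nonneg _)
  have hexp : ∀ ω, w ω * (f (q ω) - ∑ t, b (Y ω) t * f t) =
      ∑ t, f t * (w ω * (I t ω - b (Y ω) t)) := by
    intro ω
    have : f (q ω) = ∑ t, I t ω * f t := by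
      simp [I, Set.indicator_apply]
    rw [this, ← Finset.sum_sub_distrib, Finset.mul_sum]
    exact Finset.sum_congr rfl fun t _ => by ring
  simp_rw [hexp]
  rw [integral_finsetSum _ fun t _ => by
    simp_rw [mul_sub (w _)]
    exact ((hwI t).sub (hwb t)).const_mul (f t)]
  simp_rw [integral_const_mul]
  have hw0 : 0 ≤ ∫ ω, |w ω| ∂P := integral_nonneg fun _ => abs_nonneg _
  refine (Finset.abs_sum_le_sum_abs _ _).trans ?_
  rcases isEmpty_or_nonempty T with hT | ⟨⟨t0⟩⟩
  · obtain ⟨ω⟩ := P.nonempty_of_neZero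
    exact (hT.false (q ω)).elim
  have hM : 0 ≤ M := (abs_nonneg _).trans (hf t0)
  calc ∑ t, |f t * ∫ ω, w ω * (I t ω - b (Y ω) t) ∂P|
      ≤ ∑ _t : T, M * (1 / N * ∫ ω, |w ω| ∂P) := by
        refine Finset.sum_le_sum fun t _ => ?_
        rw [abs_mul]
        exact mul_le_mul (hf t) (hone t) (abs_nonneg _) hM
    _ = (Fintype.card T / N) * M * ∫ ω, |w ω| ∂P := by
        simp; ring
    _ ≤ _ := by gcongr

/-- A finite type space that approximates the beliefs of the players `i < k` about a finite-valued
variable: `q` is a joint type that determines the variable, `t i` maps joint types to types of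
player `i`, and `β i` is the belief of the types of player `i` about the joint type. -/
theorem exists_finite_typeSpace {Ω : Type*} {mΩ : MeasurableSpace Ω} (P : Measure Ω)
    [IsProbabilityMeasure P] {n : ℕ} {F : Fin n → MeasurableSpace Ω} (hF : ∀ i, F i ≤ mΩ)
    (hnest : ∀ i j : Fin n, i ≤ j → F j ≤ F i) {V : Type w} [Fintype V] {κ : Ω → V}
    (hκ : ∀ t, MeasurableSet (κ ⁻¹' {t})) {δ : ℝ} (hδ : 0 < δ) (k : ℕ) :
    ∃ (T S : Type w) (_ : Fintype T) (_ : Fintype S) (q : Ω → T) (v : T → V)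
      (t : Fin n → T → S) (β : Fin n → S → T → ℝ),
      (∀ x, MeasurableSet (q ⁻¹' {x})) ∧ (∀ ω, v (q ω) = κ ω) ∧
      ∀ i : Fin n, i.val < k → (∀ s, MeasurableSet[F i] ((fun ω => t i (q ω)) ⁻¹' {s})) ∧
        ∀ w : Ω → ℝ, Measurable[F i] w → (∀ ω, |w ω| ≤ 1) → ∀ (f : T → ℝ) (M : ℝ),
          (∀ x, |f x| ≤ M) →
          |∫ ω, w ω * (f (q ω) - ∑ x, β i (t i (q ω)) x * f x) ∂P| ≤
            δ * M * ∫ ω, |w ω| ∂P := by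
  classical
  induction k with
  | zero =>
    exact ⟨V, PUnit, inferInstance, inferInstance, κ, id, fun _ _ => PUnit.unit, fun _ _ _ => 0, hκ,
      fun _ => rfl, fun i hi => (Nat.not_lt_zero _ hi).elim⟩
  | succ k ih =>
    obtain ⟨T, S, _, _, q, v, t, β, hq, hv, h⟩ := ih
    by_cases hk : k < n
    swap
    · exact ⟨T, S, inferInstance, inferInstance, q, v, t, β, hq, hv, fun i hi => h i (by omega)⟩
    -- Player `k` forms a belief about the joint type built so far, which contains the types of the
    -- better informed players. The new signal `Y` is measurable for `F k`, hence known to every `i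
    -- ≤ k`.
    obtain ⟨S', _, Y, b, hY, hb⟩ := exists_finite_belief P (hF ⟨k, hk⟩) hq hδ
    have hQ : ∀ x, MeasurableSet ((fun ω => (q ω, Y ω)) ⁻¹' {x}) := by
      rintro ⟨x, y⟩
      have : (fun ω => (q ω, Y ω)) ⁻¹' {(x, y)} = q ⁻¹' {x} ∩ Y ⁻¹' {y} := by ext; simp
      rw [this]
      exact (hq x).inter (hF _ _ (hY y))
    -- Players `i < k` add `Y` to their old type; player `k` has `Y` alone, marked by `none`.
    -- Beliefs put no weight on joint types with another value of `Y` than the known one. The `none`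
    -- types of players beyond `k` are placeholders.
    refine ⟨T × S', Option S × S', inferInstance, inferInstance, fun ω => (q ω, Y ω),
      fun x => v x.1, fun i x => (if i.val < k then some (t i x.1) else none, x.2),
      fun i s x => if x.2 = s.2 then (s.1.elim (b s.2 x.1) fun s => β i s x.1) else 0,
      hQ, hv, fun i hi => ?_⟩
    have hFi : F ⟨k, hk⟩ ≤ F i := hnest _ _ (Fin.mk_le_mk.2 (Nat.lt_succ_iff.1 hi))
    refine ⟨?_, ?_⟩
    · rintro ⟨s, y⟩
      have hset : (fun ω => ((if i.val < k then some (t i (q ω)) else none : Option S), Y ω)) ⁻¹'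
          {(s, y)} = (fun ω => (if i.val < k then some (t i (q ω)) else none : Option S)) ⁻¹' {s} ∩
            Y ⁻¹' {y} := by ext; simp
      rw [hset]
      refine MeasurableSet.inter ?_ (hFi _ (hY y))
      by_cases hik : i.val < k
      · simp only [hik, if_true]
        cases s with
        | none =>
          convert MeasurableSet.empty
          ext; simp
        | some s =>
          convert (h i hik).1 s using 1
          ext; simp
      · simp only [hik, if_false]
        exact MeasurableSet.const _
    · intro w hw hw1 f M hf
      let B : T × S' → T → ℝ := fun z x => if i.val < k then β i (t i z.1) x else b z.2 x
      have hB : ∀ w : Ω → ℝ, Measurable[F i] w → (∀ ω, |w ω| ≤ 1) → ∀ f : T → ℝ,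
          (∀ x, |f x| ≤ M) →
          |∫ ω, w ω * (f (q ω) - ∑ x, B (q ω, Y ω) x * f x) ∂P| ≤ δ * M * ∫ ω, |w ω| ∂P := by
        intro w hw hw1 f hf
        by_cases hik : i.val < k
        · simpa only [B, hik, if_true] using (h i hik).2 w hw hw1 f M hf
        · simp only [B, hik, if_false]
          refine hb w ?_ hw1 f M hf
          have : i = ⟨k, hk⟩ := Fin.ext (le_antisymm (Nat.lt_succ_iff.1 hi) (not_lt.1 hik))
          rwa [← this]
      -- Since `Y` is known to player `i`, the test function may be cut along its values and the
      -- estimate for `T` applied to each piece with `f (·, y)`. The pieces have total mass `|w|`,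
      -- so `δ` does not grow with `k`.
      let W : S' → Ω → ℝ := fun y => (Y ⁻¹' {y}).indicator w
      have hWm : ∀ y, Measurable[F i] (W y) := fun y => hw.indicator (hFi _ (hY y))
      have hW1 : ∀ y ω, |W y ω| ≤ 1 := fun y ω => by
        simp only [W, Set.indicator_apply]
        split_ifs
        · exact hw1 ω
        · simp
      have hsum : ∀ ω, ∑ y, |W y ω| = |w ω| := fun ω => by
        have : ∀ y, |W y ω| = if Y ω = y then |w ω| else 0 := fun y => by
          simp only [W, Set.indicator_apply, Set.mem_preimage, Set.mem_singleton_iff]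
          split_ifs <;> simp
        simp [this]
      have hWint : ∀ y, Integrable (W y) P := fun y =>
        Integrable.of_bound ((hWm y).mono (hF i) le_rfl).aestronglyMeasurable 1
          (Filter.Eventually.of_forall (hW1 y))
      have hexp : ∀ ω, w ω * (f (q ω, Y ω) - ∑ x : T × S', (if x.2 = Y ω then
          ((if i.val < k then some (t i (q ω)) else none : Option S).elim (b (Y ω) x.1)
            fun s => β i s x.1) else 0) * f x) =
          ∑ y, W y ω * (f (q ω, y) - ∑ x, B (q ω, Y ω) x * f (x, y)) := by
        intro ω
        rw [Finset.sum_eq_single (Y ω)]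
        · have h1 : W (Y ω) ω = w ω := by simp [W]
          have h2 : ∀ x, (if i.val < k then some (t i (q ω)) else none : Option S).elim (b (Y ω) x)
              (fun s => β i s x) = B (q ω, Y ω) x := fun x => by
            simp only [B]
            split_ifs <;> rfl
          simp only [h1, h2, Fintype.sum_prod_type, ite_mul, zero_mul, Finset.sum_ite_eq',
            Finset.mem_univ, if_true]
        · intro y _ hy
          simp [W, Ne.symm hy]
        · simp
      simp only [hexp]
      have hint : ∀ y, Integrable
          (fun ω => W y ω * (f (q ω, y) - ∑ x, B (q ω, Y ω) x * f (x, y))) P := fun y => by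
        have := integrable_comp_of_preimage_singleton (P := P) hQ
          fun z => f (z.1, y) - ∑ x, B z x * f (x, y)
        exact this.bdd_mul (hWint y).aestronglyMeasurable (c := 1)
          (Filter.Eventually.of_forall (hW1 y))
      rw [integral_finsetSum _ fun y _ => hint y]
      refine (Finset.abs_sum_le_sum_abs _ _).trans ?_
      refine (Finset.sum_le_sum fun y _ =>
        hB (W y) (hWm y) (hW1 y) (fun x => f (x, y)) fun x => hf _).trans ?_
      rw [← Finset.mul_sum, ← integral_finsetSum _ fun y _ => (hWint y).abs]
      simp only [hsum, le_refl]

/-! ### From the finite type space to approximate best replies. -/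

/-- A game with nested information, finitely many actions, and payoffs that depend on a
finite-valued state variable `κ` has profiles of behavior strategies that are `ε`-best replies on
every event of each player's information. -/
theorem exists_finite_profile {Ω : Type*} {mΩ : MeasurableSpace Ω} (P : Measure Ω)
    [IsProbabilityMeasure P] {n : ℕ} {F : Fin n → MeasurableSpace Ω} (hF : ∀ i, F i ≤ mΩ)
    (hnest : ∀ i j : Fin n, i ≤ j → F j ≤ F i) {K : Fin n → Type*} [∀ i, Fintype (K i)]
    [∀ i, Nonempty (K i)] {V : Type*} [Fintype V] {κ : Ω → V}
    (hκ : ∀ t, MeasurableSet (κ ⁻¹' {t})) (u : Fin n → V → (∀ i, K i) → ℝ) {ε : ℝ} (hε : 0 < ε) :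
    ∃ x : ∀ i, Ω → K i → ℝ, (∀ i a, Measurable[F i] fun ω => x i ω a) ∧ (∀ i ω a, 0 ≤ x i ω a) ∧
      (∀ i ω, ∑ a, x i ω a = 1) ∧
      ∀ (i : Fin n) (y : Ω → K i → ℝ), (∀ a, Measurable[F i] fun ω => y ω a) →
        (∀ ω a, 0 ≤ y ω a) → (∀ ω, ∑ a, y ω a = 1) → ∀ E, MeasurableSet[F i] E →
        ∫ ω in E, ∑ k, u i (κ ω) k * ∏ j, Function.update (fun j => x j ω) i (y ω) j (k j) ∂P ≤
          ∫ ω in E, ∑ k, u i (κ ω) k * ∏ j, x j ω (k j) ∂P + ε * P.real E := by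
  classical
  obtain ⟨C, hC⟩ : ∃ C, ∀ i v k, |u i v k| ≤ C := by
    obtain ⟨C, hC⟩ := (Set.finite_range
      fun z : Fin n × V × (∀ i, K i) => |u z.1 z.2.1 z.2.2|).bddAbove
    exact ⟨C, fun i v k => hC ⟨(i, v, k), rfl⟩⟩
  let M : ℝ := Fintype.card (∀ i, K i) * |C|
  have hM : 0 ≤ M := by positivity
  -- The belief error costs `ε / 4` for the deviation and again for the equilibrium; the finite game
  -- contributes `ε / 2`.
  let δ : ℝ := ε / (4 * (M + 1))
  have hδ : 0 < δ := by positivity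
  have hδM : δ * M ≤ ε / 4 := by
    have : δ * (M + 1) = ε / 4 := by simp only [δ]; field_simp
    nlinarith
  obtain ⟨T, S, _, _, q, v, t, β, hq, hv, h⟩ := exists_finite_typeSpace P hF hnest hκ hδ n
  -- Payoff of player `i` from action `a` at the joint type `z`, when the others play `ξ` according
  -- to their types.
  let Φ : ∀ i, K i → (∀ p : Fin n × S, K p.1 → ℝ) → T → ℝ := fun i a ξ z =>
    ∑ k : ∀ i, K i, if k i = a then
      u i (v z) k * ∏ j ∈ Finset.univ.erase i, ξ (j, t j z) (k j) else 0
  -- The agents are the pairs (player, type). The weights `β` need not sum to one or come from a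
  -- common prior; only smoothness of the payoffs in `ξ` is used.
  obtain ⟨ξ, hξ0, hξ1, hξ⟩ := exists_approx_nash (P := Fin n × S) (K := fun p => K p.1)
    (fun p a ξ => ∑ z, β p.1 p.2 z * Φ p.1 a ξ z) (fun p a => by
      refine ContDiff.sum fun z _ => contDiff_const.mul (ContDiff.sum fun k _ => ?_)
      split_ifs
      · exact contDiff_const.mul (contDiff_prod fun j _ =>
          contDiff_pi.1 (contDiff_pi.1 contDiff_id (j, t j z)) (k j))
      · exact contDiff_const) (half_pos hε)
  have hξle : ∀ p a, ξ p a ≤ 1 := fun p a => by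
    rw [← hξ1 p]
    exact Finset.single_le_sum (f := ξ p) (fun _ _ => hξ0 p _) (Finset.mem_univ a)
  have hΦ : ∀ i a z, |Φ i a ξ z| ≤ M := by
    intro i a z
    refine (Finset.abs_sum_le_sum_abs _ _).trans
      ((Finset.sum_le_sum (g := fun _ => |C|) fun k _ => ?_).trans (by simp [M]))
    split_ifs
    · rw [abs_mul]
      have h1 : |∏ j ∈ Finset.univ.erase i, ξ (j, t j z) (k j)| ≤ 1 := by
        rw [abs_of_nonneg (Finset.prod_nonneg fun _ _ => hξ0 _ _)]
        exact Finset.prod_le_one (fun _ _ => hξ0 _ _) fun _ _ => hξle _ _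
      calc _ ≤ |C| * 1 := mul_le_mul ((hC i _ k).trans (le_abs_self C)) h1 (abs_nonneg _)
            (abs_nonneg _)
        _ = _ := mul_one _
    · simp
  let G : ∀ i, K i → S → ℝ := fun i a s => ∑ z, β i s z * Φ i a ξ z
  let x : ∀ i, Ω → K i → ℝ := fun i ω a => ξ (i, t i (q ω)) a
  have hx : ∀ i a, Measurable[F i] fun ω => x i ω a := fun i a =>
    measurable_comp_of_preimage_singleton (h i i.2).1 fun s => ξ (i, s) a
  have happrox : ∀ (i : Fin n) (y : Ω → K i → ℝ), (∀ a, Measurable[F i] fun ω => y ω a) →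
      (∀ ω a, 0 ≤ y ω a) → (∀ ω, ∑ a, y ω a = 1) → ∀ E, MeasurableSet[F i] E →
      Integrable (fun ω => ∑ a, y ω a * G i a (t i (q ω))) P ∧
      |∫ ω in E, ∑ k, u i (κ ω) k * ∏ j, Function.update (fun j => x j ω) i (y ω) j (k j) ∂P -
        ∫ ω in E, ∑ a, y ω a * G i a (t i (q ω)) ∂P| ≤ ε / 4 * P.real E := by
    intro i y hy hy0 hy1 E hE
    have hyle : ∀ ω a, y ω a ≤ 1 := fun ω a => by
      rw [← hy1 ω]
      exact Finset.single_le_sum (f := y ω) (fun _ _ => hy0 ω _) (Finset.mem_univ a)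
    have hym : ∀ a, Measurable fun ω => y ω a := fun a => (hy a).mono (hF i) le_rfl
    have hyint : ∀ a, ∀ f : T → ℝ, Integrable (fun ω => y ω a * f (q ω)) P := fun a f =>
      (integrable_comp_of_preimage_singleton hq f).bdd_mul (hym a).aestronglyMeasurable (c := 1)
        (Filter.Eventually.of_forall fun ω => by
          rw [Real.norm_of_nonneg (hy0 ω a)]; exact hyle ω a)
    have hpt : ∀ ω, ∑ k, u i (κ ω) k * ∏ j, Function.update (fun j => x j ω) i (y ω) j (k j) =
        ∑ a, y ω a * Φ i a ξ (q ω) := by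
      intro ω
      simp only [Φ, Finset.mul_sum]
      rw [Finset.sum_comm]
      refine Finset.sum_congr rfl fun k _ => ?_
      rw [Finset.sum_eq_single (k i) (fun a _ ha => by simp [ha.symm]) (by simp),
        ← Finset.mul_prod_erase _ _ (Finset.mem_univ i), if_pos rfl, Function.update_self, hv]
      rw [Finset.prod_congr rfl fun j hj => by
        rw [Function.update_of_ne (Finset.ne_of_mem_erase hj)]]
      ring
    have hi1 : Integrable (fun ω => ∑ a, y ω a * Φ i a ξ (q ω)) P :=
      integrable_finsetSum _ fun a _ => hyint a (Φ i a ξ)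
    have hi2 : Integrable (fun ω => ∑ a, y ω a * G i a (t i (q ω))) P :=
      integrable_finsetSum _ fun a _ => hyint a fun z => G i a (t i z)
    refine ⟨hi2, ?_⟩
    simp only [hpt]
    rw [← integral_sub hi1.integrableOn hi2.integrableOn, ← integral_indicator (hF i _ hE)]
    -- The test functions are the probabilities of the actions, cut off to `E`. They sum to the
    -- indicator of `E`, so the total error is `δ M` times the probability of `E`.
    let W : K i → Ω → ℝ := fun a => E.indicator fun ω => y ω a
    have hWm : ∀ a, Measurable[F i] (W a) := fun a => (hy a).indicator hE
    have hW0 : ∀ a ω, 0 ≤ W a ω := fun a ω => Set.indicator_nonneg (fun ω _ => hy0 ω a) ω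
    have hW1 : ∀ a ω, |W a ω| ≤ 1 := fun a ω => by
      rw [abs_of_nonneg (hW0 a ω)]
      exact Set.indicator_apply_le' (fun _ => hyle ω a) fun _ => zero_le_one
    have hWint : ∀ a, Integrable (W a) P := fun a =>
      Integrable.of_bound ((hWm a).mono (hF i) le_rfl).aestronglyMeasurable 1
        (Filter.Eventually.of_forall (hW1 a))
    have hexp : ∀ ω, E.indicator (fun ω => ∑ a, y ω a * Φ i a ξ (q ω) -
        ∑ a, y ω a * G i a (t i (q ω))) ω =
        ∑ a, W a ω * (Φ i a ξ (q ω) - G i a (t i (q ω))) := by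
      intro ω
      by_cases hω : ω ∈ E
      · simp [W, hω, mul_sub]
      · simp [W, hω]
    simp only [hexp]
    rw [integral_finsetSum _ fun a _ => (integrable_comp_of_preimage_singleton hq
      fun z => Φ i a ξ z - G i a (t i z)).bdd_mul (hWint a).aestronglyMeasurable (c := 1)
        (Filter.Eventually.of_forall (hW1 a))]
    refine (Finset.abs_sum_le_sum_abs _ _).trans ?_
    refine (Finset.sum_le_sum fun a _ =>
      (h i i.2).2 (W a) (hWm a) (hW1 a) (Φ i a ξ) M (hΦ i a)).trans ?_
    rw [← Finset.mul_sum, ← integral_finsetSum _ fun a _ => (hWint a).abs]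
    have hsum : ∀ ω, ∑ a, |W a ω| = E.indicator (fun _ => 1) ω := by
      intro ω
      by_cases hω : ω ∈ E
      · simp [W, hω, abs_of_nonneg (hy0 ω _), hy1]
      · simp [W, hω]
    simp only [hsum]
    rw [integral_indicator (hF i _ hE)]
    simp only [integral_const, smul_eq_mul, mul_one, measureReal_restrict_apply_univ]
    gcongr
  refine ⟨x, hx, fun i ω a => hξ0 _ _, fun i ω => hξ1 (i, t i (q ω)), fun i y hy hy0 hy1 E hE => ?_⟩
  obtain ⟨hyi, hya⟩ := happrox i y hy hy0 hy1 E hE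
  obtain ⟨hxi, hxa⟩ := happrox i (x i) (hx i) (fun ω a => hξ0 _ _) (fun ω => hξ1 (i, t i (q ω))) E hE
  have hself : ∀ ω, Function.update (fun j => x j ω) i (x i ω) = fun j => x j ω := fun ω =>
    Function.update_eq_self i _
  simp only [hself] at hxa
  have hle : ∫ ω in E, ∑ a, y ω a * G i a (t i (q ω)) ∂P ≤
      ∫ ω in E, ∑ a, x i ω a * G i a (t i (q ω)) ∂P + ε / 2 * P.real E := by
    have : ∫ ω in E, (∑ a, x i ω a * G i a (t i (q ω)) + ε / 2) ∂P =
        ∫ ω in E, ∑ a, x i ω a * G i a (t i (q ω)) ∂P + ε / 2 * P.real E := by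
      rw [integral_add hxi.integrableOn (integrable_const _)]
      simp [mul_comm]
    rw [← this]
    refine integral_mono hyi.integrableOn (hxi.integrableOn.add (integrable_const _)) fun ω => ?_
    calc ∑ a, y ω a * G i a (t i (q ω))
        ≤ ∑ a, y ω a * (∑ a, x i ω a * G i a (t i (q ω)) + ε / 2) :=
          Finset.sum_le_sum fun a _ =>
            mul_le_mul_of_nonneg_left (hξ (i, t i (q ω)) a) (hy0 ω a)
      _ = _ := by rw [← Finset.sum_mul, hy1, one_mul]
  have h1 := abs_le.1 hya
  have h2 := abs_le.1 hxa
  linarith [h1.2, h2.1]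

/-! ### Transfer between discretized payoffs and the game itself. -/

theorem integral_pi_comp_eq_sum {ι : Type*} [Fintype ι] [DecidableEq ι] {A K : ι → Type*}
    [∀ i, MeasurableSpace (A i)] [∀ i, Fintype (K i)] (μ : ∀ i, Measure (A i))
    [∀ i, IsProbabilityMeasure (μ i)] (π : ∀ i, A i → K i)
    (hπ : ∀ i k, MeasurableSet (π i ⁻¹' {k})) (f : (∀ i, K i) → ℝ) :
    ∫ a, f (fun i => π i (a i)) ∂Measure.pi μ = ∑ k, f k * ∏ i, (μ i).real (π i ⁻¹' {k i}) := by
  classical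
  let B : (∀ i, K i) → Set (∀ i, A i) := fun k => Set.univ.pi fun i => π i ⁻¹' {k i}
  have hB : ∀ k, MeasurableSet (B k) := fun k => MeasurableSet.univ_pi fun i => hπ i _
  have hexp : ∀ a : ∀ i, A i, f (fun i => π i (a i)) =
      ∑ k, f k * (B k).indicator (fun _ => (1 : ℝ)) a := by
    intro a
    rw [Finset.sum_eq_single fun i => π i (a i)]
    · simp [B]
    · intro k _ hk
      have : a ∉ B k := fun h => hk (funext fun i => (h i (Set.mem_univ i)).symm)
      simp [this]
    · simp
  simp_rw [hexp]
  rw [integral_finsetSum _ fun k _ => ((integrable_const (1 : ℝ)).indicator (hB k)).const_mul _]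
  refine Finset.sum_congr rfl fun k _ => ?_
  rw [integral_const_mul, integral_indicator (hB k)]
  simp [B, Measure.real, Measure.pi_pi, ENNReal.toReal_prod]

namespace BayesianGame

variable {n : ℕ} {Ω : Type u} [mΩ : MeasurableSpace Ω]
  {A : Fin n → Type v} [∀ i, MeasurableSpace (A i)]

theorem measurePreserving_fst_law (Γ : BayesianGame n Ω A) (s : Γ.Profile) :
    MeasurePreserving Prod.fst (Γ.law s) Γ.P := by
  have := Γ.isProbabilityMeasure_P
  exact ⟨measurable_fst, Measure.fst_compProd Γ.P (Γ.profileKernel s)⟩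

/-- Replacing the payoff by an approximation that depends on a finite-valued state variable and on
finite-valued functions of the actions changes the payoff of a profile, on any event, by at most
the integral of the approximation error. -/
theorem abs_setIntegral_law_sub_le (Γ : BayesianGame n Ω A) {K : Fin n → Type*}
    [∀ i, Fintype (K i)] {π : ∀ i, A i → K i} (hπ : ∀ i k, MeasurableSet (π i ⁻¹' {k}))
    {V : Type*} [Fintype V] {κ : Ω → V} (hκ : ∀ t, MeasurableSet (κ ⁻¹' {t}))
    (f : V → (∀ i, K i) → ℝ) {g : Ω → ℝ} (hg : Integrable g Γ.P) (i : Fin n)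
    (hfg : ∀ᵐ ω ∂Γ.P, ∀ a : ∀ i, A i, |Γ.R i (ω, a) - f (κ ω) fun j => π j (a j)| ≤ g ω)
    (s : Γ.Profile) :
    Integrable (Γ.R i) (Γ.law s) ∧ ∀ E, MeasurableSet E →
      |∫ x in E ×ˢ Set.univ, Γ.R i x ∂Γ.law s - ∫ ω in E,
        ∑ k, f (κ ω) k * ∏ j, ((s j).mixedAction ω).real (π j ⁻¹' {k j}) ∂Γ.P| ≤
      ∫ ω in E, g ω ∂Γ.P := by
  classical
  have := Γ.isProbabilityMeasure_P
  have hmp := Γ.measurePreserving_fst_law s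
  have hcell : ∀ z : V × ∀ i, K i, MeasurableSet
      ((fun x : Ω × (∀ i, A i) => (κ x.1, fun j => π j (x.2 j))) ⁻¹' {z}) := by
    rintro ⟨t, k⟩
    have : (fun x : Ω × (∀ i, A i) => (κ x.1, fun j => π j (x.2 j))) ⁻¹' {(t, k)} =
        (κ ⁻¹' {t}) ×ˢ Set.univ.pi fun j => π j ⁻¹' {k j} := by
      ext x; simp [funext_iff, Set.mem_pi]
    rw [this]
    exact (hκ t).prod (MeasurableSet.univ_pi fun j => hπ j _)
  let h : Ω × (∀ i, A i) → ℝ := fun x => f (κ x.1) fun j => π j (x.2 j)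
  have hh : Integrable h (Γ.law s) :=
    integrable_comp_of_preimage_singleton hcell fun z => f z.1 z.2
  have hgf : Integrable (fun x : Ω × (∀ i, A i) => g x.1) (Γ.law s) :=
    hmp.integrable_comp_of_integrable hg
  have hfg' : ∀ᵐ x ∂Γ.law s, ‖Γ.R i x - h x‖ ≤ g x.1 := by
    filter_upwards [hmp.quasiMeasurePreserving.ae hfg] with x hx
    exact hx x.2
  have hd : Integrable (fun x => Γ.R i x - h x) (Γ.law s) :=
    hgf.mono' ((Γ.measurable_R i).aestronglyMeasurable.sub hh.aestronglyMeasurable) hfg'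
  have hR : Integrable (Γ.R i) (Γ.law s) := by
    refine (hd.add hh).congr (Filter.Eventually.of_forall fun x => ?_)
    simp
  refine ⟨hR, fun E hE => ?_⟩
  have h1 : ∫ x in E ×ˢ Set.univ, h x ∂Γ.law s = ∫ ω in E,
      ∑ k, f (κ ω) k * ∏ j, ((s j).mixedAction ω).real (π j ⁻¹' {k j}) ∂Γ.P := by
    rw [law, Measure.setIntegral_compProd hE MeasurableSet.univ hh.integrableOn]
    refine integral_congr_ae (Filter.Eventually.of_forall fun ω => ?_)
    simp only [Measure.restrict_univ]
    exact integral_pi_comp_eq_sum _ π hπ (f (κ ω))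
  have h2 : ∫ x in E ×ˢ Set.univ, g x.1 ∂Γ.law s = ∫ ω in E, g ω ∂Γ.P := by
    rw [law, Measure.setIntegral_compProd hE MeasurableSet.univ hgf.integrableOn]
    simp
  rw [← h1, ← h2, ← integral_sub hR.integrableOn hh.integrableOn, ← Real.norm_eq_abs]
  exact norm_integral_le_of_norm_le hgf.integrableOn (ae_restrict_of_ae hfg')

/-- The behavior strategy that plays `e a` with probability `x ω a`. -/
noncomputable def Strategy.ofWeights (Γ : BayesianGame n Ω A) (i : Fin n) {K : Type*} [Fintype K]
    (e : K → A i) (x : Ω → K → ℝ) (hx : ∀ a, Measurable[Γ.F i] fun ω => x ω a)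
    (hx0 : ∀ ω a, 0 ≤ x ω a) (hx1 : ∀ ω, ∑ a, x ω a = 1) : Γ.Strategy i where
  mixedAction ω := ∑ a, ENNReal.ofReal (x ω a) • Measure.dirac (e a)
  isProbabilityMeasure_mixedAction ω := ⟨by
    simp [← ENNReal.ofReal_sum_of_nonneg fun a _ => hx0 ω a, hx1]⟩
  measurable_mixedAction := by
    refine @Measure.measurable_of_measurable_coe _ _ _ (Γ.F i) _ fun B _ => ?_
    simp only [Measure.coe_finsetSum, Finset.sum_apply, Measure.smul_apply, smul_eq_mul]
    exact Finset.measurable_sum _ fun a _ => (hx a).ennreal_ofReal.mul_const _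

theorem Strategy.ofWeights_real_preimage (Γ : BayesianGame n Ω A) (i : Fin n) {K : Type*}
    [Fintype K] {e : K → A i} {x : Ω → K → ℝ} (hx : ∀ a, Measurable[Γ.F i] fun ω => x ω a)
    (hx0 : ∀ ω a, 0 ≤ x ω a) (hx1 : ∀ ω, ∑ a, x ω a = 1) {π : A i → K}
    (hπ : ∀ k, MeasurableSet (π ⁻¹' {k})) (hπe : ∀ k, π (e k) = k) (ω : Ω) (k : K) :
    ((Strategy.ofWeights Γ i e x hx hx0 hx1).mixedAction ω).real (π ⁻¹' {k}) = x ω k := by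
  classical
  simp only [Strategy.ofWeights, Measure.real, Measure.coe_finsetSum, Finset.sum_apply,
    Measure.smul_apply, smul_eq_mul, Measure.dirac_apply' _ (hπ k)]
  rw [Finset.sum_eq_single k]
  · simp [hπe, hx0]
  · intro a _ ha
    simp [hπe, ha]
  · simp

/-- Profiles that are approximate best replies on every event of each player's information, for
games whose payoffs are approximated by functions of a finite-valued state variable and of
finite-valued functions of the actions. -/
theorem exists_profile_setIntegral_le (Γ : BayesianGame n Ω A) (hnest : Γ.NestedInformation)
    {K : Fin n → Type*} [∀ i, Fintype (K i)] {π : ∀ i, A i → K i}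
    (hπs : ∀ i, Function.Surjective (π i)) (hπ : ∀ i k, MeasurableSet (π i ⁻¹' {k}))
    {V : Type*} [Fintype V] {κ : Ω → V} (hκ : ∀ t, MeasurableSet (κ ⁻¹' {t}))
    (f : Fin n → V → (∀ i, K i) → ℝ) {g : Ω → ℝ} (hg : Integrable g Γ.P)
    (hfg : ∀ᵐ ω ∂Γ.P, ∀ (i : Fin n) (a : ∀ i, A i),
      |Γ.R i (ω, a) - f i (κ ω) fun j => π j (a j)| ≤ g ω) {ε : ℝ} (hε : 0 < ε) :
    ∃ s : Γ.Profile, ∀ (i : Fin n) (σ : Γ.Strategy i),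
      Integrable (Γ.R i) (Γ.law s) ∧
      Integrable (Γ.R i) (Γ.law (Function.update s i σ)) ∧
      ∀ E, MeasurableSet[Γ.F i] E →
        ∫ x in E ×ˢ Set.univ, Γ.R i x ∂Γ.law (Function.update s i σ) ≤
          ∫ x in E ×ˢ Set.univ, Γ.R i x ∂Γ.law s + ε * Γ.P.real E + 2 * ∫ ω in E, g ω ∂Γ.P := by
  classical
  have := Γ.isProbabilityMeasure_P
  have hne : ∀ i, Nonempty (K i) := fun i => (Γ.nonempty_action i).map (π i)
  obtain ⟨x, hx, hx0, hx1, hbest⟩ := exists_finite_profile Γ.P Γ.F_le hnest hκ f hε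
  -- The equilibrium plays one representative action of each cell.
  let s : Γ.Profile := fun i => Strategy.ofWeights Γ i (Function.surjInv (hπs i)) (x i) (hx i)
    (hx0 i) (hx1 i)
  have hs : ∀ i ω k, ((s i).mixedAction ω).real (π i ⁻¹' {k}) = x i ω k := fun i ω k =>
    Strategy.ofWeights_real_preimage Γ i (hx i) (hx0 i) (hx1 i) (hπ i)
      (Function.surjInv_eq (hπs i)) ω k
  refine ⟨s, fun i σ => ?_⟩
  have hfg' : ∀ᵐ ω ∂Γ.P, ∀ a : ∀ i, A i,
      |Γ.R i (ω, a) - f i (κ ω) fun j => π j (a j)| ≤ g ω := hfg.mono fun ω h => h i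
  obtain ⟨hI, hI'⟩ := Γ.abs_setIntegral_law_sub_le hπ hκ (f i) hg i hfg' s
  obtain ⟨hJ, hJ'⟩ := Γ.abs_setIntegral_law_sub_le hπ hκ (f i) hg i hfg' (Function.update s i σ)
  refine ⟨hI, hJ, fun E hE => ?_⟩
  have h1 := hI' E (Γ.F_le i _ hE)
  have h2 := hJ' E (Γ.F_le i _ hE)
  -- An arbitrary deviation enters the discretized payoff only through its cell probabilities.
  have h3 := hbest i (fun ω a => (σ.mixedAction ω).real (π i ⁻¹' {a}))
    (fun a => ((Measure.measurable_coe (hπ i a)).comp σ.measurable_mixedAction).ennreal_toReal)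
    (fun _ _ => measureReal_nonneg)
    (fun ω => by
      rw [sum_measureReal_preimage_singleton _ fun a _ => hπ i a]
      simp) E hE
  simp only [hs] at h1
  have hdev : ∀ j ω k, ((Function.update s i σ j).mixedAction ω).real (π j ⁻¹' {k}) =
      Function.update (fun j => x j ω) i (fun a => (σ.mixedAction ω).real (π i ⁻¹' {a})) j k := by
    intro j ω k
    by_cases hj : j = i
    · subst hj; simp
    · simp [hj, hs]
  simp only [hdev] at h2
  have h4 := abs_le.1 h1
  have h5 := abs_le.1 h2
  linarith [h4.1, h5.2]

end BayesianGame

/-! ### Bayesian equilibria for finitely many actions and payoff vectors. -/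

/-- No measurable set separates `a i` from `b i`, so the two-point map with values `a` and `b` is
measurable even for the trivial σ-field on `Bool`; its composition with `h` is then constant. -/
theorem eq_of_measurableAtom_eq {ι : Type*} {A : ι → Type*} [∀ i, MeasurableSpace (A i)]
    {h : (∀ i, A i) → ℝ} (hh : Measurable h) {a b : ∀ i, A i}
    (hab : ∀ i, measurableAtom (a i) = measurableAtom (b i)) : h a = h b := by
  have hφ : @Measurable Bool _ ⊥ _ fun t => (cond t a b : ∀ i, A i) := by
    refine (@measurable_pi_iff _ _ _ ⊥ _ _).2 fun i S hS => ?_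
    refine MeasurableSpace.measurableSet_bot_iff.2 ?_
    have hiff : a i ∈ S ↔ b i ∈ S := by
      constructor <;> intro hm
      · exact mem_of_mem_measurableAtom (hab i ▸ mem_measurableAtom_self (b i)) hS hm
      · exact mem_of_mem_measurableAtom (hab i ▸ mem_measurableAtom_self (a i)) hS hm
    by_cases hb : b i ∈ S
    · right
      ext t
      cases t <;> simp [hb, hiff]
    · left
      ext t
      cases t <;> simp [hb, hiff]
  have h1 := MeasurableSpace.measurableSet_bot_iff.1 ((hh.comp hφ) (measurableSet_singleton (h a)))
  rcases h1 with h1 | h1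
  · have : true ∈ (∅ : Set Bool) := by rw [← h1]; simp
    exact this.elim
  · have : false ∈ (Set.univ : Set Bool) := Set.mem_univ _
    rw [← h1] at this
    exact (by simpa using this : h b = h a).symm

namespace BayesianGame

variable {n : ℕ} {Ω : Type u} [mΩ : MeasurableSpace Ω]
  {A : Fin n → Type v} [∀ i, MeasurableSpace (A i)]

theorem measurable_condPayoff (Γ : BayesianGame n Ω A) (s : Γ.Profile) (i : Fin n) :
    Measurable[Γ.F i] (Γ.condPayoff s i) := by
  have h1 : Measurable[Γ.infoProd i] ((Γ.law s)[Γ.R i | Γ.infoProd i]) :=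
    stronglyMeasurable_condExp.measurable
  refine @Measurable.comp _ _ _ (Γ.F i) (Γ.infoProd i) _ _ _ h1 ?_
  exact measurable_comap_iff.2 measurable_id

theorem integrable_condPayoff (Γ : BayesianGame n Ω A) (s : Γ.Profile) (i : Fin n) :
    Integrable (Γ.condPayoff s i) Γ.P := by
  have h1 : Integrable (Γ.condPayoff s i ∘ Prod.fst) (Γ.law s) :=
    (integrable_condExp (m := Γ.infoProd i) (f := Γ.R i)).congr
      (Filter.Eventually.of_forall fun x => Γ.condExp_eq_condPayoff s i x)
  exact ((Γ.measurePreserving_fst_law s).integrable_comp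
    ((Γ.measurable_condPayoff s i).mono (Γ.F_le i) le_rfl).aestronglyMeasurable).1 h1

/-- Makes the almost sure comparison of conditional payoffs a comparison of integrals over the
events of `Γ.F i`. -/
theorem setIntegral_condPayoff (Γ : BayesianGame n Ω A) (s : Γ.Profile) (i : Fin n)
    (hR : Integrable (Γ.R i) (Γ.law s)) {E : Set Ω} (hE : MeasurableSet[Γ.F i] E) :
    ∫ ω in E, Γ.condPayoff s i ω ∂Γ.P = ∫ x in E ×ˢ Set.univ, Γ.R i x ∂Γ.law s := by
  have := Γ.isProbabilityMeasure_P
  have hle : Γ.infoProd i ≤ (inferInstance : MeasurableSpace (Ω × ∀ i, A i)) :=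
    (MeasurableSpace.comap_mono (Γ.F_le i)).trans measurable_fst.comap_le
  have hE' : MeasurableSet[Γ.infoProd i] (E ×ˢ (Set.univ : Set (∀ i, A i))) :=
    ⟨E, hE, by ext; simp⟩
  rw [← setIntegral_condExp hle hR hE']
  simp_rw [condExp_eq_condPayoff]
  have h1 : Integrable (fun x : Ω × (∀ i, A i) => Γ.condPayoff s i x.1) (Γ.law s) :=
    (Γ.measurePreserving_fst_law s).integrable_comp_of_integrable (Γ.integrable_condPayoff s i)
  rw [law, Measure.setIntegral_compProd (Γ.F_le i _ hE) MeasurableSet.univ h1.integrableOn]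
  simp

theorem exists_isBayesianEquilibrium (Γ : BayesianGame n Ω A) (hfin : Γ.FiniteActionsAndPayoffs)
    (hnest : Γ.NestedInformation) {ε : ℝ} (hε : 0 < ε) :
    ∃ s : Γ.Profile, Γ.IsBayesianEquilibrium ε s := by
  classical
  have := Γ.isProbabilityMeasure_P
  obtain ⟨hA, V, hV, hRV⟩ := hfin
  -- The σ-field of a finite action set need not separate points. Cells are therefore its atoms, on
  -- which payoffs are constant by measurability.
  let π : ∀ i, A i → Set.range (measurableAtom (β := A i)) := fun i => Set.rangeFactorization _
  have hπs : ∀ i, Function.Surjective (π i) := fun i => Set.rangeFactorization_surjective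
  have : ∀ i, Fintype (Set.range (measurableAtom (β := A i))) := fun i => Fintype.ofFinite _
  have : Fintype V := hV.fintype
  have hπ : ∀ i k, MeasurableSet (π i ⁻¹' {k}) := by
    rintro i ⟨_, b, rfl⟩
    convert MeasurableSet.measurableAtom_of_countable b using 1
    ext a
    simp only [π, Set.mem_preimage, Set.mem_singleton_iff, Set.rangeFactorization, Subtype.ext_iff]
    exact ⟨fun h => (h : measurableAtom a = measurableAtom b) ▸ mem_measurableAtom_self a,
      measurableAtom_eq_of_mem⟩
  let ρ : Ω → Fin n → (∀ i, A i) → ℝ := fun ω i a => Γ.R i (ω, a)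
  -- The value `none` collects the null set of states whose payoff vector lies outside `V`.
  let κ : Ω → Option V := fun ω => if h : ρ ω ∈ V then some ⟨ρ ω, h⟩ else none
  have hsome : ∀ c : V, MeasurableSet (κ ⁻¹' {some c}) := by
    intro c
    have : κ ⁻¹' {some c} = ⋂ i, ⋂ a, (fun ω => Γ.R i (ω, a)) ⁻¹' {c.1 i a} := by
      ext ω
      have h1 : κ ω = some c ↔ ρ ω = c.1 := by
        by_cases h : ρ ω ∈ V
        · simp [κ, h, Subtype.ext_iff]
        · simp only [κ, h, dite_false, reduceCtorEq, false_iff]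
          exact fun h' => h (h' ▸ c.2)
      simp only [Set.mem_preimage, Set.mem_singleton_iff, h1, Set.mem_iInter, ρ, funext_iff]
    rw [this]
    exact MeasurableSet.iInter fun i => MeasurableSet.iInter fun a =>
      ((Γ.measurable_R i).comp measurable_prodMk_right) (measurableSet_singleton _)
  have hκ : ∀ t, MeasurableSet (κ ⁻¹' {t}) := by
    rintro (_ | c)
    · have : κ ⁻¹' {none} = (⋃ c, κ ⁻¹' {some c})ᶜ := by
        ext ω
        cases h : κ ω <;> simp [h]
      rw [this]
      exact (MeasurableSet.iUnion hsome).compl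
    · exact hsome c
  let f : Fin n → Option V → (∀ i, Set.range (measurableAtom (β := A i))) → ℝ := fun i t k =>
    t.elim 0 fun c => c.1 i fun j => Function.surjInv (hπs j) (k j)
  have hfg : ∀ᵐ ω ∂Γ.P, ∀ (i : Fin n) (a : ∀ i, A i),
      |Γ.R i (ω, a) - f i (κ ω) fun j => π j (a j)| ≤ 0 := by
    filter_upwards [hRV] with ω hω i a
    have h1 : κ ω = some ⟨ρ ω, hω⟩ := dif_pos hω
    simp only [f, h1, Option.elim_some, ρ]
    rw [abs_nonpos_iff, sub_eq_zero]
    refine eq_of_measurableAtom_eq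
      (h := fun a => Γ.R i (ω, a)) ((Γ.measurable_R i).comp measurable_prodMk_left) fun j => ?_
    exact (congrArg Subtype.val (Function.surjInv_eq (hπs j) (π j (a j)))).symm
  obtain ⟨s, hs⟩ := Γ.exists_profile_setIntegral_le hnest hπs hπ hκ f (integrable_const 0) hfg hε
  refine ⟨s, fun i σ => ?_⟩
  obtain ⟨hI, hJ, hle⟩ := hs i σ
  refine ⟨hJ, ?_⟩
  -- Both sides are `Γ.F i`-measurable; after restricting the measure to that field, only its events
  -- have to be tested.
  refine ae_of_ae_trim (Γ.F_le i) ?_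
  have hm1 := (Γ.measurable_condPayoff (Function.update s i σ) i).stronglyMeasurable
  have hm2 := ((Γ.measurable_condPayoff s i).add_const ε).stronglyMeasurable
  have hi2 : Integrable (fun ω => Γ.condPayoff s i ω + ε) Γ.P :=
    (Γ.integrable_condPayoff s i).add (integrable_const ε)
  refine ae_le_of_forall_setIntegral_le ((Γ.integrable_condPayoff _ i).trim (Γ.F_le i) hm1)
    (hi2.trim (Γ.F_le i) hm2) fun E hE _ => ?_
  rw [← setIntegral_trim (Γ.F_le i) hm1 hE, ← setIntegral_trim (Γ.F_le i) hm2 hE,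
    integral_add (Γ.integrable_condPayoff s i).integrableOn (integrable_const ε),
    Γ.setIntegral_condPayoff _ i hJ hE, Γ.setIntegral_condPayoff _ i hI hE]
  have := hle E hE
  simp only [integral_zero, mul_zero, add_zero] at this
  simpa [mul_comm] using this

end BayesianGame

/-! ### Harsanyi equilibria for continuous payoffs on compact action spaces. -/

open Filter Topology ENNReal in
/-- A random continuous function on a compact space with integrable supremum has a modulus of
continuity that is small in mean. -/
theorem exists_integrable_modulus {Ω X : Type*} {mΩ : MeasurableSpace Ω} (P : Measure Ω)
    [PseudoMetricSpace X] [CompactSpace X] [Nonempty X] {r : Ω → X → ℝ}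
    (hr : ∀ x, Measurable fun ω => r ω x) (hc : ∀ ω, Continuous (r ω))
    (hint : ∫⁻ ω, ⨆ x, ‖r ω x‖ₑ ∂P < ⊤) {η : ℝ} (hη : 0 < η) :
    ∃ δ > 0, ∃ g : Ω → ℝ, Integrable g P ∧ (∀ ω, 0 ≤ g ω) ∧ ∫ ω, g ω ∂P ≤ η ∧
      ∀ᵐ ω ∂P, ∀ x y, dist x y < δ → |r ω x - r ω y| ≤ g ω := by
  let d : ℕ → X := TopologicalSpace.denseSeq X
  let D : ℕ → ℝ := fun m => 1 / ((m : ℝ) + 1)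
  have hD : ∀ m, 0 < D m := fun m => Nat.one_div_pos_of_nat
  -- The oscillation at scale `D m` over a countable dense set, hence measurable in `ω`; by
  -- continuity it bounds the oscillation over all pairs at that scale.
  let G : ℕ → Ω → ℝ≥0∞ := fun m ω =>
    ⨆ p : ℕ × ℕ, ⨆ _ : dist (d p.1) (d p.2) < D m, ‖r ω (d p.1) - r ω (d p.2)‖ₑ
  have hGm : ∀ m, Measurable (G m) := fun m =>
    Measurable.iSup fun p => Measurable.iSup fun _ => ((hr _).sub (hr _)).enorm
  have hGle : ∀ m ω, G m ω ≤ 2 * ⨆ x, ‖r ω x‖ₑ := by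
    intro m ω
    refine iSup₂_le fun p _ => (enorm_sub_le).trans ?_
    rw [two_mul]
    exact add_le_add (le_iSup (fun x => ‖r ω x‖ₑ) _) (le_iSup (fun x => ‖r ω x‖ₑ) _)
  have hmod : ∀ m ω x y, dist x y < D m → ‖r ω x - r ω y‖ₑ ≤ G m ω := by
    intro m ω x y hxy
    let U : Set (X × X) := {p | dist p.1 p.2 < D m}
    have hU : IsOpen U := isOpen_lt continuous_dist continuous_const
    let C : Set (X × X) := {p | ‖r ω p.1 - r ω p.2‖ₑ ≤ G m ω}
    have hC : IsClosed C := isClosed_le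
      (((hc ω).comp continuous_fst).sub ((hc ω).comp continuous_snd)).enorm continuous_const
    have hd : DenseRange (Prod.map d d) :=
      (TopologicalSpace.denseRange_denseSeq X).prodMap (TopologicalSpace.denseRange_denseSeq X)
    have hsub : U ∩ Set.range (Prod.map d d) ⊆ C := by
      rintro _ ⟨hp, p, rfl⟩
      exact le_iSup₂ (f := fun (p : ℕ × ℕ) (_ : dist (d p.1) (d p.2) < D m) =>
        ‖r ω (d p.1) - r ω (d p.2)‖ₑ) p hp
    exact closure_minimal hsub hC (Dense.open_subset_closure_inter hd hU (show (x, y) ∈ U from hxy))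
  have hfin : ∫⁻ ω, 2 * ⨆ x, ‖r ω x‖ₑ ∂P ≠ ⊤ := by
    rw [lintegral_const_mul' _ _ (by simp)]
    exact (ENNReal.mul_lt_top (by simp) hint).ne
  -- The oscillation is dominated by twice the integrable supremum and vanishes at each `ω` by
  -- uniform continuity.
  have hlim : Tendsto (fun m => ∫⁻ ω, G m ω ∂P) atTop (𝓝 (∫⁻ _, 0 ∂P)) := by
    refine tendsto_lintegral_of_dominated_convergence _ hGm
      (fun m => Eventually.of_forall (hGle m)) hfin (Eventually.of_forall fun ω => ?_)
    rw [ENNReal.tendsto_nhds_zero]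
    intro e he
    obtain ⟨e', he', hee⟩ : ∃ e' : ℝ, 0 < e' ∧ ENNReal.ofReal e' ≤ e := by
      rcases eq_or_ne e ⊤ with rfl | h
      · exact ⟨1, one_pos, le_top⟩
      · exact ⟨e.toReal, ENNReal.toReal_pos he.ne' h, (ENNReal.ofReal_toReal h).le⟩
    obtain ⟨δ, hδ, hu⟩ := Metric.uniformContinuous_iff.1
      (CompactSpace.uniformContinuous_of_continuous (hc ω)) e' he'
    filter_upwards [tendsto_one_div_add_atTop_nhds_zero_nat.eventually_lt_const hδ] with m hm
    refine iSup₂_le fun p hp => le_trans ?_ hee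
    rw [← ofReal_norm, ← dist_eq_norm]
    exact ENNReal.ofReal_le_ofReal (hu (hp.trans hm)).le
  simp only [lintegral_zero] at hlim
  obtain ⟨m, hm⟩ := ((ENNReal.tendsto_nhds_zero.1 hlim) (ENNReal.ofReal η) (by simpa)).exists
  have htop : ∫⁻ ω, G m ω ∂P ≠ ⊤ := (hm.trans_lt ENNReal.ofReal_lt_top).ne
  refine ⟨D m, hD m, fun ω => (G m ω).toReal,
    integrable_toReal_of_lintegral_ne_top (hGm m).aemeasurable htop,
    fun ω => ENNReal.toReal_nonneg, ?_, ?_⟩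
  · rw [integral_toReal (hGm m).aemeasurable (ae_lt_top (hGm m) htop)]
    exact ENNReal.toReal_le_of_le_ofReal hη.le hm
  · filter_upwards [ae_lt_top (hGm m) htop] with ω hω x y hxy
    have := ENNReal.toReal_mono hω.ne (hmod m ω x y hxy)
    rwa [toReal_enorm, Real.norm_eq_abs] at this

/-- A compact metric space has finite measurable partitions into sets of small diameter. -/
theorem exists_finite_partition (Y : Type v) [PseudoMetricSpace Y] [CompactSpace Y]
    [MeasurableSpace Y] [OpensMeasurableSpace Y] {δ : ℝ} (hδ : 0 < δ) :
    ∃ (K : Type v) (_ : Fintype K) (π : Y → K), Function.Surjective π ∧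
      (∀ k, MeasurableSet (π ⁻¹' {k})) ∧ ∀ x y, π x = π y → dist x y < δ := by
  classical
  obtain ⟨t, ht⟩ := (isCompact_univ (X := Y)).elim_nhds_subcover (fun y => Metric.ball y (δ / 2))
    fun y _ => Metric.ball_mem_nhds y (half_pos hδ)
  -- Cells group the points that lie in the same balls of a finite cover; two points of a cell share
  -- a ball of radius `δ / 2`.
  let f : Y → t → Prop := fun x y => dist x y < δ / 2
  refine ⟨Set.range f, Fintype.ofFinite _, Set.rangeFactorization f,
    Set.rangeFactorization_surjective, fun k => ?_, fun x y hxy => ?_⟩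
  · have : Set.rangeFactorization f ⁻¹' {k} = ⋂ y : t, {x : Y | dist x (y : Y) < δ / 2 ↔ k.1 y} := by
      ext x
      simp [Set.rangeFactorization, Subtype.ext_iff, funext_iff, f]
    rw [this]
    refine MeasurableSet.iInter fun y => ?_
    have hball : MeasurableSet {x : Y | dist x y < δ / 2} := measurableSet_ball
    by_cases hk : k.1 y
    · simpa [hk] using hball
    · convert hball.compl using 1
      ext x
      simp [hk]
  · have hx : x ∈ ⋃ y ∈ t, Metric.ball y (δ / 2) := ht.2 (Set.mem_univ x)
    obtain ⟨z, hz, hxz⟩ := Set.mem_iUnion₂.1 hx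
    have h1 : f x = f y := congrArg Subtype.val hxy
    have h2 : f y ⟨z, hz⟩ := h1 ▸ (show f x ⟨z, hz⟩ from hxz)
    calc dist x y ≤ dist x z + dist y z := dist_triangle_right x y z
      _ < δ / 2 + δ / 2 := add_lt_add hxz h2
      _ = δ := add_halves δ

theorem exists_simpleFunc_integral_abs_sub_le {Ω : Type*} {mΩ : MeasurableSpace Ω} {P : Measure Ω}
    {f : Ω → ℝ} (hf : Integrable f P) {η : ℝ} (hη : 0 < η) :
    ∃ φ : SimpleFunc Ω ℝ, Integrable (fun ω => |f ω - φ ω|) P ∧ ∫ ω, |f ω - φ ω| ∂P ≤ η := by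
  obtain ⟨φ, hφ, hφi⟩ := (memLp_one_iff_integrable.2 hf).exists_simpleFunc_eLpNorm_sub_lt
    ENNReal.one_ne_top (ε := ENNReal.ofReal η) (by simpa)
  have hi : Integrable (f - ⇑φ) P := hf.sub (memLp_one_iff_integrable.1 hφi)
  refine ⟨φ, hi.abs, ?_⟩
  rw [eLpNorm_one_eq_lintegral_enorm] at hφ
  have := integral_norm_eq_lintegral_enorm hi.aestronglyMeasurable
  simp only [Pi.sub_apply, Real.norm_eq_abs] at this
  rw [this]
  exact ENNReal.toReal_le_of_le_ofReal hη.le hφ.le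

namespace BayesianGame

variable {n : ℕ} {Ω : Type u} [mΩ : MeasurableSpace Ω]
  {A : Fin n → Type v} [∀ i, MeasurableSpace (A i)]

theorem exists_isHarsanyiEquilibrium [∀ i, MetricSpace (A i)] (Γ : BayesianGame n Ω A)
    (hΓ : Γ.IntegrableContinuousPayoffs) (hnest : Γ.NestedInformation) {ε : ℝ} (hε : 0 < ε) :
    ∃ s : Γ.Profile, Γ.IsHarsanyiEquilibrium ε s := by
  classical
  have := Γ.isProbabilityMeasure_P
  obtain ⟨hA, hcont, hint⟩ := hΓ
  have := fun i => (hA i).1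
  have := fun i => (hA i).2
  have := Γ.nonempty_action
  have hsec : ∀ i (a : ∀ i, A i), Measurable fun ω => Γ.R i (ω, a) := fun i a =>
    (Γ.measurable_R i).comp measurable_prodMk_right
  -- The moduli will contribute at most `ε / 8` to the integral of `g`, and the simple-function
  -- errors, through `η₂`, another `ε / 8`.
  let η₁ : ℝ := ε / (8 * (n + 1))
  have hη₁ : 0 < η₁ := by positivity
  choose δ hδ g₁ hg₁i hg₁0 hg₁le hg₁ using fun i =>
    exists_integrable_modulus Γ.P (hsec i) (hcont i) (hint i) hη₁
  obtain ⟨δ₀, hδ₀, hδle⟩ : ∃ δ₀ > 0, ∀ i, δ₀ ≤ δ i := by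
    rcases isEmpty_or_nonempty (Fin n) with h | h
    · exact ⟨1, one_pos, fun i => h.elim i⟩
    · obtain ⟨j, hj⟩ := Finite.exists_min δ
      exact ⟨δ j, hδ j, hj⟩
  choose K instK π hπs hπ hπδ using fun i => exists_finite_partition (A i) hδ₀
  let e : (∀ i, K i) → ∀ i, A i := fun k j => Function.surjInv (hπs j) (k j)
  let J := Fin n × ∀ i, K i
  let η₂ : ℝ := ε / (8 * (Fintype.card J + 1))
  have hη₂ : 0 < η₂ := by positivity
  have hRi : ∀ i a, Integrable (fun ω => Γ.R i (ω, a)) Γ.P := by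
    refine fun i a => ⟨(hsec i a).aestronglyMeasurable, ?_⟩
    exact (lintegral_mono fun ω => le_iSup (fun a => ‖Γ.R i (ω, a)‖ₑ) a).trans_lt (hint i)
  choose φ hφi hφ using fun z : J =>
    exists_simpleFunc_integral_abs_sub_le (hRi z.1 (e z.2)) hη₂
  let c : Ω → J → ℝ := fun ω z => φ z ω
  have hcfin : (Set.range c).Finite := by
    refine (Set.Finite.pi' fun z => (φ z).finite_range).subset ?_
    rintro _ ⟨ω, rfl⟩ z
    exact Set.mem_range_self ω
  have : Fintype (Set.range c) := hcfin.fintype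
  -- The state variable lists the simple-function values that approximate the payoffs at all
  -- representative action profiles.
  let κ : Ω → Set.range c := Set.rangeFactorization c
  have hκ : ∀ t, MeasurableSet (κ ⁻¹' {t}) := by
    intro t
    have : κ ⁻¹' {t} = ⋂ z, φ z ⁻¹' {t.1 z} := by
      ext ω
      simp [κ, Set.rangeFactorization, Subtype.ext_iff, funext_iff, c]
    rw [this]
    exact MeasurableSet.iInter fun z => (φ z).measurableSet_fiber _
  let f : Fin n → Set.range c → (∀ i, K i) → ℝ := fun i t k => t.1 (i, k)
  let g : Ω → ℝ := fun ω => ∑ i, g₁ i ω + ∑ z : J, |Γ.R z.1 (ω, e z.2) - φ z ω|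
  have hgs₁ : Integrable (fun ω => ∑ i, g₁ i ω) Γ.P := integrable_finsetSum _ fun i _ => hg₁i i
  have hgs₂ : Integrable (fun ω => ∑ z : J, |Γ.R z.1 (ω, e z.2) - φ z ω|) Γ.P :=
    integrable_finsetSum _ fun z _ => hφi z
  have hg : Integrable g Γ.P := hgs₁.add hgs₂
  have hgle : ∫ ω, g ω ∂Γ.P ≤ ε / 4 := by
    have hn : ∀ N : ℕ, (N : ℝ) * (ε / (8 * (N + 1))) ≤ ε / 8 := fun N => by
      rw [mul_div_assoc', div_le_div_iff₀ (by positivity) (by norm_num)]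
      nlinarith
    have h1 : ∫ ω, ∑ i, g₁ i ω ∂Γ.P ≤ ε / 8 := by
      rw [integral_finsetSum _ fun i _ => hg₁i i]
      exact (Finset.sum_le_sum fun i _ => hg₁le i).trans (by simpa [η₁] using hn n)
    have h2 : ∫ ω, ∑ z : J, |Γ.R z.1 (ω, e z.2) - φ z ω| ∂Γ.P ≤ ε / 8 := by
      rw [integral_finsetSum _ fun z _ => hφi z]
      refine (Finset.sum_le_sum fun z _ => hφ z).trans ?_
      rw [Finset.sum_const, nsmul_eq_mul, Finset.card_univ]
      exact hn _
    rw [integral_add hgs₁ hgs₂]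
    linarith
  have hfg : ∀ᵐ ω ∂Γ.P, ∀ (i : Fin n) (a : ∀ i, A i),
      |Γ.R i (ω, a) - f i (κ ω) fun j => π j (a j)| ≤ g ω := by
    filter_upwards [ae_all_iff.2 hg₁] with ω hω i a
    let k : ∀ i, K i := fun j => π j (a j)
    have hd : dist a (e k) < δ i := by
      refine lt_of_lt_of_le ((dist_pi_lt_iff hδ₀).2 fun j => hπδ j _ _ ?_) (hδle i)
      exact (Function.surjInv_eq (hπs j) (π j (a j))).symm
    have h1 : |Γ.R i (ω, a) - Γ.R i (ω, e k)| ≤ ∑ i, g₁ i ω :=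
      (hω i a (e k) hd).trans
        (Finset.single_le_sum (f := fun i => g₁ i ω) (fun i _ => hg₁0 i ω) (Finset.mem_univ i))
    have h2 : |Γ.R i (ω, e k) - φ (i, k) ω| ≤ ∑ z : J, |Γ.R z.1 (ω, e z.2) - φ z ω| :=
      Finset.single_le_sum (f := fun z : J => |Γ.R z.1 (ω, e z.2) - φ z ω|)
        (fun _ _ => abs_nonneg _) (Finset.mem_univ (i, k))
    exact (abs_sub_le _ (Γ.R i (ω, e k)) _).trans (add_le_add h1 h2)
  obtain ⟨s, hs⟩ :=
    Γ.exists_profile_setIntegral_le hnest hπs hπ hκ f hg hfg (half_pos hε)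
  refine ⟨s, fun i σ => ?_⟩
  obtain ⟨_, hJ, hle⟩ := hs i σ
  refine ⟨hJ, ?_⟩
  -- Only the whole space is used: `g` is small in mean but not on every event relative to its
  -- probability. The total is `ε / 2` from the finite game plus twice `ε / 4` from `g`.
  have := hle Set.univ MeasurableSet.univ
  simp only [Set.univ_prod_univ, setIntegral_univ, probReal_univ, mul_one] at this
  simp only [payoff]
  linarith

end BayesianGame

theorem theorem1 :
    (∀ (n : ℕ) (_ : 2 ≤ n) (Ω : Type u) [MeasurableSpace Ω]
        (A : Fin n → Type v) [∀ i, MeasurableSpace (A i)] (Γ : BayesianGame n Ω A),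
        Γ.FiniteActionsAndPayoffs → Γ.NestedInformation →
        ∀ ε : ℝ, 0 < ε → ∃ s : Γ.Profile, Γ.IsBayesianEquilibrium ε s) ∧
    (∀ (n : ℕ) (_ : 2 ≤ n) (Ω : Type u) [MeasurableSpace Ω]
        (A : Fin n → Type v) [∀ i, MeasurableSpace (A i)] [∀ i, MetricSpace (A i)]
        (Γ : BayesianGame n Ω A),
        Γ.IntegrableContinuousPayoffs → Γ.NestedInformation →
        ∀ ε : ℝ, 0 < ε → ∃ s : Γ.Profile, Γ.IsHarsanyiEquilibrium ε s) := by
  exact ⟨fun _ _ _ _ _ _ Γ hΓ hnest _ hε => Γ.exists_isBayesianEquilibrium hΓ hnest hε,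
    fun _ _ _ _ _ _ _ Γ hΓ hnest _ hε => Γ.exists_isHarsanyiEquilibrium hΓ hnest hε⟩
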